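/- **Input.** Let $A$ be a finite set. For every $p\in A$ let $I_p\subset\mathbb R$ be a nonempty closed bounded interval (possibly a single point). Let $T$ be a set of unordered pairs of elements of $A$, and for every $\{p,q\}\in T$ let $I_{p,q}\subseteq I_p\cap I_q$ be a nonempty closed interval. Let $\mathcal I_A=\{I_p\}$ and $\mathcal I_T=\{I_{p,q}\}$ be the resulting labelled families. For a subfamily $\mathcal I\subseteq\mathcal I_A\sqcup\mathcal I_T$ let $\sim$ be the equivalence relation on $\bigsqcup_{I_p\in\mathcal I}\{p\}\times I_p$ generated by $(p,x)\sim(q,x)$ for $x\in I_{p,q}\in\mathcal I$. For $x\in\mathbb R$ let $\mathcal P^{\mathcal I}_x$ be the partition of $\{p : I_p\in\mathcal I,\ x\in I_p\}$ into the classes of the relation $p\sim_x q :\Leftrightarrow (p,x)\sim(q,x)$. For sets of reals, $J<K$ means $x<y$ for all $x\in J$, $y\in K$. **Data.** The algorithm maintains a list $J_1<J_2<\dots$ of intervals (the cells). Each cell $J$ carries a union-find structure $J.\mathrm{UF}$, a forest of rooted trees on a subset of $A$ given by parent pointers; $\mathcal P(J)$ is the partition into vertex sets of trees, and $[p]_J\in\mathcal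 P(J)$ is the set containing $p$. For consecutive cells $J<J'$ it stores a bipartite graph $G(J,J')$ between the roots of $J.\mathrm{UF}$ and the roots of $J'.\mathrm{UF}$. $J.\mathrm{pred}$ and $J.\mathrm{succ}$ are the neighbours of $J$ in the list. The operation find-set$(p)$ returns the root of the tree of $p$ and redirects the pointers on the path from $p$ to that root; make-set$(p)$ adds a new one-vertex tree; union of the trees with roots $r\neq r'$ hangs one root below the other, and either of the two may be chosen to survive. **Algorithm.** Sort $\mathcal I_A\sqcup\mathcal I_T$ by increasing left endpoint, with members of $\mathcal I_A$ before members of $\mathcal I_T$ in case of ties (other ties are broken arbitrarily). Start with the single cell $\mathbb R$ with empty union-find structure. Process the intervals $I$ of the sorted list one after the other. - *Splitting* a cell $J\nsubseteq I$ that meets $I$: call find-set at all stored elements, replace $J$ by $J\cap I$ and by the nonempty ones among the parts of $J$ to the left and to the right of $I$; every part gets a copy of $J.\mathrm{UF}$, consecutive parts are joined by the identity graph on the roots, and the first and last part inherit the graphs $G(J.\mathrm{pred},J)$ and $G(J,J.\mathrm{succ})$. - *$I=I_p$*: for each cell $J$ meeting $I$, from left to right, split $J$ if $J\nsubseteq I$,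 and let $L=J\cap I$. Do make-set$(p)$ in $L.\mathrm{UF}$, and add the edge $p\leftrightarrow p$ to $G(L.\mathrm{pred},L)$ if $p$ is stored in $L.\mathrm{pred}$. - *$I=I_{p,q}$*: set first $=$ TRUE. For each cell $J$ meeting $I$, from left to right, call find-set at $p$ and $q$ in $J.\mathrm{UF}$. If the results differ, split $J$ if $J\nsubseteq I$, and let $L=J\cap I$. Unite the trees of $p$ and $q$ in $L.\mathrm{UF}$; if $r$ is the surviving and $r'$ the absorbed root, then in $G(L.\mathrm{pred},L)$ and $G(L,L.\mathrm{succ})$ the neighbours of $r'$ become neighbours of $r$ and $r'$ ceases to be a vertex. If first is TRUE and $\mathcal P(L)=\mathcal P(L.\mathrm{pred})$, replace the interval of $L.\mathrm{pred}$ by $L.\mathrm{pred}\cup L$, delete $L$, and let $G(L.\mathrm{pred},L.\mathrm{succ})$ be the composition of $G(L.\mathrm{pred},L)$ and $G(L,L.\mathrm{succ})$. Then set first $=$ FALSE. **Lemma.** For every such sorted list, every choice of surviving roots, and every prefix $\mathcal I$ of the sorted list, the following holds after the intervals of $\mathcal I$ have been processed. The cells are listed from left to right, and: (i) for each cell $J$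 we have $\mathcal P(J)=\mathcal P^{\mathcal I}_x$ for every $x\in J$; (ii) the cells form the coarsest partition of $\mathbb R$ into nonempty intervals on each of which $x\mapsto\mathcal P^{\mathcal I}_x$ is constant: they form such a partition, and every other such partition refines it; (iii) for consecutive cells $J<J'$, the pair $x,y$ is joined by an edge of $G(J,J')$ if and only if $x$ is a root of $J.\mathrm{UF}$, $y$ is a root of $J'.\mathrm{UF}$, and $[x]_J\cap[y]_{J'}\neq\emptyset$; (iv) if $\mathcal I$ is nonempty and $I$ is its last interval, then for all cells $J<J'$ with $J\nless I$ and every $r\in A$ stored in $J'.\mathrm{UF}$, $r$ is also stored in $J.\mathrm{UF}$ and $[r]_{J'}\subseteq[r]_J$. -/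

import Mathlib

namespace ReebAlg

/-! ## Input, gluing space and fibre partitions -/

/-- The input: a closed interval `I_p` for every `p : A`, a finite set `pairs` of unordered
pairs, and a closed interval `I_{p,q} ⊆ I_p ∩ I_q` for every pair in it.  `NonemptyInterval ℝ` is
Mathlib's type of intervals `[a, b]` with `a ≤ b`, and `≤` on it is inclusion. -/
structure Input (A : Type*) where
  ground : A → NonemptyInterval ℝ
  pairs : Finset (Sym2 A)
  glue : {e // e ∈ pairs} → NonemptyInterval ℝ
  glue_le : ∀ e : {e // e ∈ pairs}, ∀ p ∈ e.1, glue e ≤ ground p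

variable {A : Type*}

namespace Input

/-- Labels of the input intervals: `Sum.inl p` is the label of `I_p`, and `Sum.inr e` the label of
`I_{p,q}` for `e = {p,q}`. -/
abbrev Item (D : Input A) : Type _ := A ⊕ {e // e ∈ D.pairs}

/-- The interval with a given label. -/
def interval (D : Input A) : D.Item → NonemptyInterval ℝ
  | Sum.inl p => D.ground p
  | Sum.inr e => D.glue e

/-- `i` may precede `j` in the sorted list: its left endpoint is smaller, or the left endpoints
agree and it is not the case that `i` is a gluing interval and `j` an interval `I_p`. -/
def MayPrecede (D : Input A) (i j : D.Item) : Prop :=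
  (D.interval i).fst < (D.interval j).fst ∨
    ((D.interval i).fst = (D.interval j).fst ∧ (i.isRight → j.isRight))

/-- `l` lists every input interval exactly once, by increasing left endpoint, with the intervals
`I_p` before the intervals `I_{p,q}` in case of ties. -/
def IsSortedList (D : Input A) (l : List D.Item) : Prop :=
  l.Nodup ∧ (∀ i, i ∈ l) ∧ l.Pairwise D.MayPrecede

/-- The disjoint union of the `{p} × I_p` over those `I_p` whose label is in `S`. -/
def Point (D : Input A) (S : Set D.Item) : Type _ :=
  {z : A × ℝ // Sum.inl z.1 ∈ S ∧ z.2 ∈ D.ground z.1}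

/-- The generating relations `(p,x) ∼ (q,x)` for `x ∈ I_{p,q}`, where `I_{p,q}` has label in `S`. -/
def GlueRel (D : Input A) (S : Set D.Item) (z w : D.Point S) : Prop :=
  z.1.2 = w.1.2 ∧ ∃ e : {e // e ∈ D.pairs},
    Sum.inr e ∈ S ∧ e.1 = s(z.1.1, w.1.1) ∧ z.1.2 ∈ D.glue e

/-- The equivalence relation `∼` generated by the gluings. -/
def gluing (D : Input A) (S : Set D.Item) : Setoid (D.Point S) :=
  Relation.EqvGen.setoid (D.GlueRel S)

/-- The relation `p ∼_x q` on those `p` with label in `S` and `x ∈ I_p`. -/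
def SimAt (D : Input A) (S : Set D.Item) (x : ℝ) (p q : A) : Prop :=
  ∃ z w : D.Point S, z.1 = (p, x) ∧ w.1 = (q, x) ∧ (D.gluing S) z w

/-- The fibre partition `P_x^S`: the set of equivalence classes of `∼_x` on
`{p | the label of I_p is in S and x ∈ I_p}`. -/
def fibrePartition (D : Input A) (S : Set D.Item) (x : ℝ) : Set (Set A) :=
  {C | ∃ p, (Sum.inl p ∈ S ∧ x ∈ D.ground p) ∧ C = {q | D.SimAt S x p q}}

end Input

/-! ## Union-find forests -/

/-- A union-find structure on a subset of `A`, given by parent pointers: `parent p = none` if `p`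
is not stored, and `parent r = some r` if `r` is a root. -/
structure Forest (A : Type*) where
  parent : A → Option A

namespace Forest

/-- The structure that stores nothing. -/
def empty : Forest A := ⟨fun _ => none⟩

/-- `p` is a vertex of the forest. -/
def Stored (F : Forest A) (p : A) : Prop := F.parent p ≠ none

/-- `r` is a root of the forest. -/
def IsRoot (F : Forest A) (r : A) : Prop := F.parent r = some r

/-- One step along the parent pointers (roots stay put). -/
def up (F : Forest A) (p : A) : A := (F.parent p).getD p

/-- The end of the path of parent pointers that starts at `p`; a path has fewer than `|A|` steps
before it reaches the root. -/
noncomputable def root (F : Forest A) (p : A) : A := F.up^[Nat.card A] p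

open Classical in
/-- The value returned by find-set: the root of the tree that contains `p`. -/
noncomputable def find (F : Forest A) (p : A) : Option A :=
  if F.Stored p then some (F.root p) else none

open Classical in
/-- The forest after a call of find-set at `p` (path compression): all vertices on the path from
`p` to its root now point to the root. -/
noncomputable def compress (F : Forest A) (p : A) : Forest A :=
  ⟨fun x => if F.Stored p ∧ ∃ k : ℕ, F.up^[k] p = x then some (F.root p) else F.parent x⟩

/-- The forest after find-set has been called at every vertex. -/
noncomputable def compressAll [Fintype A] (F : Forest A) : Forest A :=
  (Finset.univ : Finset A).toList.foldl compress F

open Classical in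
/-- make-set: a new one-vertex tree `{p}`. -/
noncomputable def makeSet (F : Forest A) (p : A) : Forest A :=
  ⟨Function.update F.parent p (some p)⟩

open Classical in
/-- Hang the tree with root `r'` below the root `r`. -/
noncomputable def link (F : Forest A) (r r' : A) : Forest A :=
  ⟨Function.update F.parent r' (some r)⟩

/-- The set `[p]` of the stored partition that contains `p` (empty if `p` is not stored). -/
def cls (F : Forest A) (p : A) : Set A :=
  {q | F.Stored p ∧ F.Stored q ∧ F.root q = F.root p}

/-- The partition (of the set of stored elements) that the forest encodes. -/
def partition (F : Forest A) : Set (Set A) :=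
  {C | ∃ p, F.Stored p ∧ C = F.cls p}

end Forest

/-! ## The algorithm -/

/-- An entry `J` of the list partition-of-reals: its underlying interval, its union-find
structure, and the bipartite graph `G(J, J.succ)`, as a relation between the roots of `J` and the
roots of `J.succ`.  For the last entry of the list, the third component has no meaning. -/
structure Entry (A : Type*) where
  cell : Set ℝ
  uf : Forest A
  next : A → A → Prop

/-- `J < K` for sets of reals. -/
def Below (J K : Set ℝ) : Prop := ∀ x ∈ J, ∀ y ∈ K, x < y

open Classical in
/-- If the cell of `J` is contained in `I`, nothing is done.  Otherwise `J` is split: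
find-set is called at every stored element, and `J` is replaced by `J ∩ I` and by the nonempty
ones among the part of `J` to the left of `I` and the part of `J` to the right of `I`.
All parts receive the union-find structure of `J`, consecutive parts are joined by the identity
graph on the roots, and the last part keeps the graph to the successor of `J`.
The result is (what lies to the left, the part inside `I`, what lies to the right). -/
noncomputable def split [Fintype A] (J : Entry A) (I : Set ℝ) :
    List (Entry A) × Entry A × List (Entry A) :=
  if J.cell ⊆ I then ([], J, []) else
    let F := J.uf.compressAll
    let idG : A → A → Prop := fun x y => x = y ∧ F.IsRoot x
    let lo : Set ℝ := {x | x ∈ J.cell ∧ Below {x} I}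
    let hi : Set ℝ := {x | x ∈ J.cell ∧ Below I {x}}
    (if lo.Nonempty then [⟨lo, F, idG⟩] else [],
      ⟨J.cell ∩ I, F, if hi.Nonempty then idG else J.next⟩,
      if hi.Nonempty then [⟨hi, F, J.next⟩] else [])

/-- Add an edge `p ↔ p` to `G(K, K.succ)` if `p` is stored in `K`. -/
def addSelfEdge (p : A) (K : Entry A) : Entry A :=
  { K with next := fun a b => K.next a b ∨ (K.uf.Stored p ∧ a = p ∧ b = p) }

/-- The root `r'` of `K.succ` is absorbed by the root `r`: in `G(K, K.succ)` the neighbours of `r'`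
become neighbours of `r`, and `r'` is no longer a vertex. -/
def absorbRight (r r' : A) (K : Entry A) : Entry A :=
  { K with next := fun a b => b ≠ r' ∧ (K.next a b ∨ (b = r ∧ K.next a r')) }

/-- The root `r'` of `J` is absorbed by the root `r`: `r'` is linked below `r`, and in
`G(J, J.succ)` the neighbours of `r'` become neighbours of `r`, and `r'` is no longer a vertex. -/
noncomputable def absorb (r r' : A) (J : Entry A) : Entry A :=
  { J with
    uf := J.uf.link r r'
    next := fun a b => a ≠ r' ∧ (J.next a b ∨ (a = r ∧ J.next r' b)) }

/-- Body of the inner loop for `I = I_p`, at the entry `J`.  The list `done` holds the entries to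
the left of `J`, nearest first; so its head is `J.pred`.  The result is the list of all entries up
to and including (the parts of) `J`, nearest first. -/
noncomputable def visitGround [Fintype A] (p : A) (I : Set ℝ)
    (done : List (Entry A)) (J : Entry A) : List (Entry A) :=
  open Classical in
  if (J.cell ∩ I).Nonempty then
    let s := split J I
    let L : Entry A := { s.2.1 with uf := s.2.1.uf.makeSet p }
    s.2.2 ++ L :: (s.1 ++ done).modifyHead (addSelfEdge p)
  else J :: done

/-- The test for equality with the predecessor, and the deletion: if `J` and `K = J.pred` encode
the same partition, the cell of `K` becomes `K ∪ J`, the entry `J` is deleted, and the two graphs at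
`J` are composed. -/
noncomputable def mergeWithPred (J : Entry A) : List (Entry A) → List (Entry A)
  | [] => [J]
  | K :: done =>
    open Classical in
    if J.uf.partition = K.uf.partition then
      { K with cell := K.cell ∪ J.cell, next := Relation.Comp K.next J.next } :: done
    else J :: K :: done

/-- Body of the inner loop for `I = I_{p,q}`, at the entry `J`; `done` is as in `visitGround`, and
the Boolean is the variable `first`.  The union operation is free to choose which of the two roots
survives; `keep` makes this choice, for each cell `J ∩ I` in which a union takes place. -/
noncomputable def visitGlue [Fintype A] (keep : Set ℝ → Bool) (p q : A) (I : Set ℝ)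
    (st : List (Entry A) × Bool) (J : Entry A) : List (Entry A) × Bool :=
  open Classical in
  if (J.cell ∩ I).Nonempty then
    let J' : Entry A := { J with uf := (J.uf.compress p).compress q }
    match J'.uf.find p, J'.uf.find q with
    | some a, some b =>
      if a ≠ b then
        let s := split J' I
        let r := if keep (J.cell ∩ I) then a else b
        let r' := if keep (J.cell ∩ I) then b else a
        let L := absorb r r' s.2.1
        let done := (s.1 ++ st.1).modifyHead (absorbRight r r')
        (s.2.2 ++ (if st.2 then mergeWithPred L done else L :: done), false)
      else (J' :: st.1, st.2)
    | _, _ => (J' :: st.1, st.2)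
  else (J :: st.1, st.2)

/-- One pass through the outer loop: the inner loop visits the entries from left to right. -/
noncomputable def step [Fintype A] (D : Input A) (keep : Sym2 A → Set ℝ → Bool)
    (l : List (Entry A)) : D.Item → List (Entry A)
  | Sum.inl p => (l.foldl (visitGround p (D.ground p : Set ℝ)) []).reverse
  | Sum.inr e =>
    (l.foldl (visitGlue (keep e.1) (Quot.out e.1).1 (Quot.out e.1).2 (D.glue e : Set ℝ))
      ([], true)).1.reverse

/-- The list partition-of-reals after the outer loop has run through the list `items`, starting
from the single cell `ℝ` with the empty union-find structure. -/
noncomputable def run [Fintype A] (D : Input A) (keep : Sym2 A → Set ℝ → Bool)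
    (items : List D.Item) : List (Entry A) :=
  items.foldl (step D keep) [⟨Set.univ, Forest.empty, fun _ _ => False⟩]

/-! ## Partitions of the line -/

/-- `Q` is a partition of `ℝ` into nonempty intervals on each of which `P` is constant. -/
def IsAdapted (P : ℝ → Set (Set A)) (Q : Set (Set ℝ)) : Prop :=
  Setoid.IsPartition Q ∧ (∀ J ∈ Q, J.OrdConnected) ∧ ∀ J ∈ Q, ∀ x ∈ J, ∀ y ∈ J, P x = P y

/-- `Q` is the coarsest partition of `ℝ` into intervals on each of which `P` is constant. -/
def IsCoarsestAdapted (P : ℝ → Set (Set A)) (Q : Set (Set ℝ)) : Prop :=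
  IsAdapted P Q ∧ ∀ Q', IsAdapted P Q' → ∀ K ∈ Q', ∃ J ∈ Q, K ⊆ J

end ReebAlg

/-! One invariant, `Correct`, is carried along the sorted list: the cells subdivide the line with
sound forests and graphs, the tree relation of each cell is the fibre relation `SimAt` at each of
its points, and neighbouring cells carry different relations. The last clause is what makes the
subdivision coarsest: an interval meeting two cells contains, by convexity, points of two adjacent
cells, where the partitions differ (`Correct.isCoarsestAdapted`).

The main difficulty is to keep neighbours distinct. Inserting $I_p$ adds the singleton class $\{p\}$
over $I_p$ and changes nothing elsewhere (`simAt_insert_inl`). Adding a singleton is injective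
(`addPoint_injective`), and $p$ is absent off $I_p$, so distinct neighbours stay distinct.

Inserting $I_{p,q}$ unites two classes over it (`simAt_insert_inr_of_mem`), which can make
neighbours equal. Here the sorting enters: to the right of all left endpoints seen so far, `SimAt`
can only shrink as $x$ moves right (`simAt_anti`). Hence, among the cells meeting $I_{p,q}$, those
where $p$ and $q$ are already joined precede those where they are separate. Along the latter the old
relations are comparable, and uniting is injective on them (`IsPartialEquiv.unite_injective`). So
only the first united cell can coincide with its predecessor, and one test guarded by `first`
suffices. At the right end $p$ and $q$ are not joined in the next cell, so it differs too. `GlueInv`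
carries this argument through the inner loop.

The graphs join roots of trees with a common vertex; the `Link` lemmas follow this property through
every update, including composition at a merge. Clause (iv) is once more `simAt_anti`. -/

namespace ReebAlg

variable {A : Type*}

/-! ## Union-find forests -/

namespace Forest

/-- Every stored element reaches a root along the parent pointers. -/
def WellFormed (F : Forest A) : Prop := ∀ p, F.Stored p → ∃ k : ℕ, F.IsRoot (F.up^[k] p)

/-- `p` and `q` lie in the same tree. -/
def Rel (F : Forest A) (p q : A) : Prop := q ∈ F.cls p

theorem IsRoot.stored {F : Forest A} {r : A} (h : F.IsRoot r) : F.Stored r := by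
  unfold IsRoot at h
  simp [Stored, h]

theorem IsRoot.up_eq {F : Forest A} {r : A} (h : F.IsRoot r) : F.up r = r := by
  unfold IsRoot at h
  simp [up, h]

theorem up_of_not_stored {F : Forest A} {p : A} (h : ¬ F.Stored p) : F.up p = p := by
  simp only [Stored, not_not] at h
  simp [up, h]

theorem root_of_not_stored {F : Forest A} {p : A} (h : ¬ F.Stored p) : F.root p = p :=
  Function.iterate_fixed (up_of_not_stored h) _

/-- The vertices on a path up to its first root are pairwise distinct, so that root is reached in
fewer than $|A|$ steps; the remaining steps in the definition of `root` stay there. -/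
theorem root_eq_of_isRoot_iterate [Finite A] {F : Forest A} {p : A} {k : ℕ}
    (h : F.IsRoot (F.up^[k] p)) : F.root p = F.up^[k] p := by
  classical
  have hex : ∃ k, F.IsRoot (F.up^[k] p) := ⟨k, h⟩
  have hm := Nat.find_spec hex
  have hmin := fun m (hm : m < Nat.find hex) => Nat.find_min hex hm
  have hk : Nat.find hex ≤ k := Nat.find_min' hex h
  generalize Nat.find hex = m at hm hmin hk
  have after : ∀ n, m ≤ n → F.up^[n] p = F.up^[m] p := by
    intro n hn
    obtain ⟨d, rfl⟩ := Nat.exists_eq_add_of_le' hn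
    rw [Function.iterate_add_apply, Function.iterate_fixed hm.up_eq]
  have hcard : m + 1 ≤ Nat.card A := by
    have hinj : Function.Injective (fun i : Fin (m + 1) => F.up^[(i : ℕ)] p) := by
      -- If positions $i<j$ agree, cutting out the loop between them reaches the root at position
      -- $m-j+i<m$, against minimality of $m$.
      have key : ∀ i j : ℕ, i < j → j ≤ m → F.up^[i] p ≠ F.up^[j] p := by
        intro i j hij hj he
        apply hmin (m - j + i) (by omega)
        rw [Function.iterate_add_apply, he, ← Function.iterate_add_apply,
          Nat.sub_add_cancel hj]
        exact hm
      intro i j hij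
      by_contra hne
      rcases Nat.lt_or_gt_of_ne (fun h => hne (Fin.ext h)) with hlt | hlt
      · exact key i j hlt (by omega) hij
      · exact key j i hlt (by omega) hij.symm
    simpa using Nat.card_le_card_of_injective _ hinj
  rw [root, after _ (by omega), after k hk]

theorem WellFormed.isRoot_root [Finite A] {F : Forest A} (hF : F.WellFormed) {p : A}
    (hp : F.Stored p) : F.IsRoot (F.root p) := by
  obtain ⟨k, hk⟩ := hF p hp
  rwa [root_eq_of_isRoot_iterate hk]

theorem IsRoot.root_eq {F : Forest A} {r : A} (h : F.IsRoot r) : F.root r = r :=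
  Function.iterate_fixed h.up_eq _

theorem WellFormed.root_iterate [Finite A] {F : Forest A} (hF : F.WellFormed) {p : A}
    (hp : F.Stored p) (j : ℕ) : F.root (F.up^[j] p) = F.root p := by
  have h := (hF.isRoot_root hp).up_eq
  rw [root, ← Function.iterate_add_apply, Nat.add_comm, Function.iterate_add_apply]
  exact Function.iterate_fixed h j

theorem rel_iff {F : Forest A} {p q : A} :
    F.Rel p q ↔ F.Stored p ∧ F.Stored q ∧ F.root p = F.root q :=
  ⟨fun h => ⟨h.1, h.2.1, h.2.2.symm⟩, fun h => ⟨h.1, h.2.1, h.2.2.symm⟩⟩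

theorem rel_self {F : Forest A} {p : A} : F.Rel p p ↔ F.Stored p := by
  simp [rel_iff]

theorem Rel.symm {F : Forest A} {p q : A} (h : F.Rel p q) : F.Rel q p := by
  rw [rel_iff] at *
  exact ⟨h.2.1, h.1, h.2.2.symm⟩

theorem Rel.trans {F : Forest A} {p q r : A} (h : F.Rel p q) (h' : F.Rel q r) : F.Rel p r := by
  rw [rel_iff] at *
  exact ⟨h.1, h'.2.1, h.2.2.trans h'.2.2⟩

/-- `F'` is a well-formed forest with the same trees and the same roots as `F`. -/
structure Similar (F' F : Forest A) : Prop where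
  wellFormed : F'.WellFormed
  stored : ∀ p, F'.Stored p ↔ F.Stored p
  root : ∀ p, F'.root p = F.root p

theorem Similar.refl {F : Forest A} (hF : F.WellFormed) : F.Similar F :=
  ⟨hF, fun _ => Iff.rfl, fun _ => rfl⟩

theorem Similar.trans {F G H : Forest A} (h : F.Similar G) (h' : G.Similar H) : F.Similar H :=
  ⟨h.1, fun p => (h.2 p).trans (h'.2 p), fun p => (h.3 p).trans (h'.3 p)⟩

theorem Similar.rel_eq {F G : Forest A} (h : F.Similar G) : F.Rel = G.Rel := by
  funext p q
  simp [rel_iff, h.stored, h.root]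

/-- Path compression only shortens paths inside a tree. That the roots survive matters as much as
the partition, since the graphs are indexed by roots. -/
theorem WellFormed.compress_similar [Finite A] {F : Forest A} (hF : F.WellFormed) (p : A) :
    (F.compress p).Similar F := by
  classical
  have hroot : ∀ r, F.IsRoot r → (F.compress p).IsRoot r := by
    intro r hr
    unfold IsRoot compress
    dsimp only
    split_ifs with h
    · obtain ⟨hp, k, rfl⟩ := h
      rw [root_eq_of_isRoot_iterate hr]
    · exact hr
  have hst : ∀ x, (F.compress p).Stored x ↔ F.Stored x := by
    intro x
    unfold Stored compress
    dsimp only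
    split_ifs with h
    · obtain ⟨hp, k, rfl⟩ := h
      refine iff_of_true (by simp) fun hx => ?_
      -- An unstored element is its own root, but a vertex on the path of `p` has the stored root of
      -- `p`.
      have hx' : ¬ F.Stored (F.up^[k] p) := fun h => h hx
      have h1 := hF.root_iterate hp k
      rw [root_of_not_stored hx'] at h1
      exact hx' (h1 ▸ (hF.isRoot_root hp).stored)
    · rfl
  have hreach : ∀ (k : ℕ) (x : A), F.IsRoot (F.up^[k] x) →
      ∃ k', (F.compress p).up^[k'] x = F.up^[k] x := by
    intro k
    induction k with
    | zero => exact fun x _ => ⟨0, rfl⟩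
    | succ k ih =>
      intro x hx
      by_cases h : F.Stored p ∧ ∃ j : ℕ, F.up^[j] p = x
      · refine ⟨1, ?_⟩
        have h1 : (F.compress p).up x = F.root p := by simp only [up, compress, if_pos h,
          Option.getD_some]
        obtain ⟨hp, j, rfl⟩ := h
        rw [Function.iterate_one, h1, ← root_eq_of_isRoot_iterate hx, hF.root_iterate hp]
      · obtain ⟨k', hk'⟩ := ih (F.up x) hx
        refine ⟨k' + 1, ?_⟩
        have h1 : (F.compress p).up x = F.up x := by simp only [up, compress, if_neg h]
        rw [Function.iterate_succ_apply, h1, hk', Function.iterate_succ_apply]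
  have hmain : ∀ x, F.Stored x → ∃ k', (F.compress p).IsRoot ((F.compress p).up^[k'] x) ∧
      (F.compress p).up^[k'] x = F.root x := by
    intro x hx
    obtain ⟨k, hk⟩ := hF x hx
    obtain ⟨k', hk'⟩ := hreach k x hk
    exact ⟨k', hk' ▸ hroot _ hk, by rw [hk', root_eq_of_isRoot_iterate hk]⟩
  refine ⟨fun x hx => ?_, hst, fun x => ?_⟩
  · obtain ⟨k, hk, -⟩ := hmain x ((hst x).1 hx)
    exact ⟨k, hk⟩
  · by_cases hx : F.Stored x
    · obtain ⟨k, hk, hk'⟩ := hmain x hx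
      rw [root_eq_of_isRoot_iterate hk, hk']
    · rw [root_of_not_stored hx, root_of_not_stored (mt (hst x).1 hx)]

theorem WellFormed.compressAll_similar [Fintype A] {F : Forest A} (hF : F.WellFormed) :
    F.compressAll.Similar F := by
  unfold compressAll
  generalize (Finset.univ : Finset A).toList = l
  induction l generalizing F with
  | nil => exact .refl hF
  | cons p l ih =>
    have h := hF.compress_similar p
    exact (ih h.wellFormed).trans h

theorem stored_makeSet {F : Forest A} {p x : A} :
    (F.makeSet p).Stored x ↔ F.Stored x ∨ x = p := by
  by_cases h : x = p
  · subst h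
    simp [Stored, makeSet]
  · simp [Stored, makeSet, h]

/-- `up` fixes unstored elements as well as roots, so turning `p` from the one into the other leaves
`up` unchanged. -/
theorem root_makeSet {F : Forest A} {p : A} (hp : ¬ F.Stored p) (x : A) :
    (F.makeSet p).root x = F.root x := by
  have : (F.makeSet p).up = F.up := by
    funext x
    by_cases h : x = p
    · subst h
      rw [up_of_not_stored hp]
      simp [up, makeSet]
    · simp [up, makeSet, h]
  rw [root, root, this]

theorem WellFormed.makeSet {F : Forest A} (hF : F.WellFormed) {p : A} (hp : ¬ F.Stored p) :
    (F.makeSet p).WellFormed := by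
  have hup : (F.makeSet p).up = F.up := by
    funext x
    by_cases h : x = p
    · subst h
      rw [up_of_not_stored hp]
      simp [up, Forest.makeSet]
    · simp [up, Forest.makeSet, h]
  intro x hx
  rw [hup]
  rcases stored_makeSet.1 hx with hx | rfl
  · obtain ⟨k, hk⟩ := hF x hx
    refine ⟨k, ?_⟩
    have hne : F.up^[k] x ≠ p := fun h => hp (h ▸ hk.stored)
    unfold IsRoot at hk ⊢
    simpa [Forest.makeSet, hne] using hk
  · exact ⟨0, by simp [IsRoot, Forest.makeSet]⟩

theorem stored_link {F : Forest A} {r r' x : A} (hr' : F.IsRoot r') :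
    (F.link r r').Stored x ↔ F.Stored x := by
  by_cases h : x = r'
  · subst h
    exact iff_of_true (by simp [Stored, link]) hr'.stored
  · simp [Stored, link, h]

/-- A path in `F` survives linking until it meets `r'`, where one further step leads to `r`. A
single `k` serves both well-formedness and the value of the new root. -/
theorem link_reaches [Finite A] {F : Forest A} (hF : F.WellFormed) {r r' : A} (hr : F.IsRoot r)
    (hr' : F.IsRoot r') (hne : r ≠ r') {x : A} (hx : F.Stored x) :
    ∃ k, (F.link r r').IsRoot ((F.link r r').up^[k] x) ∧
      (F.root x = r' → (F.link r r').up^[k] x = r) ∧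
      (F.root x ≠ r' → (F.link r r').up^[k] x = F.root x) := by
  have hup : (F.link r r').up r' = r := by simp [up, link]
  have hreach : ∀ (k : ℕ) (x : A), F.IsRoot (F.up^[k] x) → ∃ k',
      (F.up^[k] x = r' → (F.link r r').up^[k'] x = r) ∧
      (F.up^[k] x ≠ r' → (F.link r r').up^[k'] x = F.up^[k] x) := by
    intro k
    induction k with
    | zero =>
      intro x _
      by_cases h : x = r'
      · subst h
        exact ⟨1, by simp [hup]⟩
      · exact ⟨0, by simp [h]⟩
    | succ k ih =>
      intro x hx
      by_cases h : x = r'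
      · subst h
        have h1 : F.up^[k + 1] x = x := Function.iterate_fixed hr'.up_eq _
        exact ⟨1, fun _ => hup, fun h => absurd h1 h⟩
      · obtain ⟨k', hk'⟩ := ih (F.up x) hx
        have h1 : (F.link r r').up x = F.up x := by simp [up, link, h]
        refine ⟨k' + 1, ?_⟩
        rwa [Function.iterate_succ_apply, Function.iterate_succ_apply, h1]
  obtain ⟨k, hk⟩ := hF x hx
  obtain ⟨k', hk'⟩ := hreach k x hk
  rw [← root_eq_of_isRoot_iterate hk] at hk'
  refine ⟨k', ?_, hk'⟩
  by_cases h : F.root x = r'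
  · rw [hk'.1 h]
    unfold IsRoot at hr ⊢
    simpa [link, hne] using hr
  · rw [hk'.2 h]
    have := hF.isRoot_root hx
    unfold IsRoot at this ⊢
    simpa [link, h] using this

section Link

variable [Finite A] {F : Forest A} {r r' : A}

theorem WellFormed.link (hF : F.WellFormed) (hr : F.IsRoot r) (hr' : F.IsRoot r')
    (hne : r ≠ r') : (F.link r r').WellFormed := fun x hx => by
  obtain ⟨k, hk, -⟩ := link_reaches hF hr hr' hne ((stored_link hr').1 hx)
  exact ⟨k, hk⟩

theorem root_link_of_eq (hF : F.WellFormed) (hr : F.IsRoot r) (hr' : F.IsRoot r')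
    (hne : r ≠ r') {x : A} (hx : F.Stored x) (h : F.root x = r') : (F.link r r').root x = r := by
  obtain ⟨k, hk, hk', -⟩ := link_reaches hF hr hr' hne hx
  rw [root_eq_of_isRoot_iterate hk, hk' h]

theorem root_link_of_ne (hF : F.WellFormed) (hr : F.IsRoot r) (hr' : F.IsRoot r')
    (hne : r ≠ r') {x : A} (hx : F.Stored x) (h : F.root x ≠ r') :
    (F.link r r').root x = F.root x := by
  obtain ⟨k, hk, -, hk'⟩ := link_reaches hF hr hr' hne hx
  rw [root_eq_of_isRoot_iterate hk, hk' h]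

end Link

end Forest

/-! ## Partial equivalence relations -/

/-- `R` with the additional singleton class `{p}`. -/
def AddPoint (R : A → A → Prop) (p a b : A) : Prop := R a b ∨ (a = p ∧ b = p)

/-- `R` with the classes of `p` and `q` united. -/
def Unite (R : A → A → Prop) (p q a b : A) : Prop :=
  R a b ∨ (R a p ∧ R q b) ∨ (R a q ∧ R p b)

theorem unite_comm (R : A → A → Prop) (p q : A) : Unite R p q = Unite R q p := by
  funext a b
  simp only [Unite, or_comm (a := R a p ∧ R q b)]

theorem addPoint_injective {R R' : A → A → Prop} {p : A} (h : ∀ b, ¬ R p b) (h' : ∀ b, ¬ R' p b)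
    (he : AddPoint R p = AddPoint R' p) : R = R' := by
  funext a b
  have := congrFun₂ he a b
  simp only [AddPoint, eq_iff_iff] at this ⊢
  constructor
  · intro hab
    rcases this.1 (.inl hab) with h1 | ⟨rfl, rfl⟩
    · exact h1
    · exact absurd hab (h _)
  · intro hab
    rcases this.2 (.inl hab) with h1 | ⟨rfl, rfl⟩
    · exact h1
    · exact absurd hab (h' _)

/-- Symmetric and transitive relations. -/
structure IsPartialEquiv (R : A → A → Prop) : Prop where
  symm : ∀ {a b}, R a b → R b a
  trans : ∀ {a b c}, R a b → R b c → R a c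

/-- Uniting the classes of `p` and `q` is injective on comparable relations in which `p` and `q`
are in different classes. -/
theorem IsPartialEquiv.unite_injective {R R' : A → A → Prop} {p q : A} (h : IsPartialEquiv R)
    (hle : ∀ a b, R' a b → R a b) (hpq : ¬ R p q) (he : Unite R p q = Unite R' p q) : R = R' := by
  funext a b
  have := congrFun₂ he a b
  simp only [Unite, eq_iff_iff] at this ⊢
  refine ⟨fun hab => ?_, hle a b⟩
  -- If the pair were related in `Unite R' p q` only through the union, then `hle` and `hab` would
  -- already connect `p` to `q` in `R`.
  rcases this.1 (.inl hab) with h1 | ⟨h1, h2⟩ | ⟨h1, h2⟩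
  · exact h1
  · exact absurd (h.trans (h.symm (hle _ _ h1)) (h.trans hab (h.symm (hle _ _ h2)))) hpq
  · exact absurd (h.trans (hle _ _ h2) (h.trans (h.symm hab) (hle _ _ h1))) hpq

/-- The set of classes of a partial equivalence relation. -/
def classes (R : A → A → Prop) : Set (Set A) := {C | ∃ p, R p p ∧ C = {q | R p q}}

theorem IsPartialEquiv.le_of_classes_eq {R R' : A → A → Prop} (hR : IsPartialEquiv R)
    (hR' : IsPartialEquiv R') (h : classes R = classes R') {a b : A} (hab : R a b) : R' a b := by
  have haa := hR.trans hab (hR.symm hab)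
  have : {q | R a q} ∈ classes R' := h ▸ ⟨a, haa, rfl⟩
  obtain ⟨p, -, hp⟩ := this
  have h1 : R' p a := by
    have : a ∈ {q | R a q} := haa
    rwa [hp] at this
  have h2 : R' p b := by
    have : b ∈ {q | R a q} := hab
    rwa [hp] at this
  exact hR'.trans (hR'.symm h1) h2

theorem IsPartialEquiv.classes_eq_iff {R R' : A → A → Prop} (hR : IsPartialEquiv R)
    (hR' : IsPartialEquiv R') : classes R = classes R' ↔ R = R' := by
  refine ⟨fun h => ?_, fun h => by rw [h]⟩
  funext a b
  exact propext ⟨hR.le_of_classes_eq hR' h, hR'.le_of_classes_eq hR h.symm⟩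

namespace Forest

theorem isPartialEquiv_rel (F : Forest A) : IsPartialEquiv F.Rel := ⟨Rel.symm, Rel.trans⟩

theorem partition_eq_classes (F : Forest A) : F.partition = classes F.Rel := by
  ext C
  simp only [partition, classes, rel_self]
  rfl

theorem partition_eq_iff {F G : Forest A} : F.partition = G.partition ↔ F.Rel = G.Rel := by
  rw [partition_eq_classes, partition_eq_classes,
    F.isPartialEquiv_rel.classes_eq_iff G.isPartialEquiv_rel]

theorem WellFormed.rel_makeSet [Finite A] {F : Forest A} (hF : F.WellFormed) {p : A}
    (hp : ¬ F.Stored p) : (F.makeSet p).Rel = AddPoint F.Rel p := by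
  have hne : ∀ x, F.Stored x → F.root x ≠ p := fun x hx h =>
    hp (h ▸ (hF.isRoot_root hx).stored)
  have hpp := root_of_not_stored hp
  funext a b
  simp only [rel_iff, AddPoint, stored_makeSet, root_makeSet hp, eq_iff_iff]
  constructor
  · rintro ⟨ha | rfl, hb | rfl, h⟩
    · exact .inl ⟨ha, hb, h⟩
    · exact absurd (h.trans hpp) (hne a ha)
    · exact absurd (h.symm.trans hpp) (hne b hb)
    · exact .inr ⟨rfl, rfl⟩
  · rintro (⟨ha, hb, h⟩ | ⟨rfl, rfl⟩)
    · exact ⟨.inl ha, .inl hb, h⟩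
    · exact ⟨.inr rfl, .inr rfl, rfl⟩

theorem WellFormed.rel_link [Finite A] {F : Forest A} (hF : F.WellFormed) {p q : A}
    (hp : F.Stored p) (hq : F.Stored q) (hne : F.root p ≠ F.root q) :
    (F.link (F.root p) (F.root q)).Rel = Unite F.Rel p q := by
  have hrp := hF.isRoot_root hp
  have hrq := hF.isRoot_root hq
  funext a b
  simp only [rel_iff, Unite, stored_link hrq, eq_iff_iff]
  by_cases ha : F.Stored a
  swap
  · simp [ha]
  by_cases hb : F.Stored b
  swap
  · simp [hb]
  have ha1 := root_link_of_eq hF hrp hrq hne ha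
  have ha2 := root_link_of_ne hF hrp hrq hne ha
  have hb1 := root_link_of_eq hF hrp hrq hne hb
  have hb2 := root_link_of_ne hF hrp hrq hne hb
  by_cases ha3 : F.root a = F.root q <;> by_cases hb3 : F.root b = F.root q
  · simp [ha1 ha3, hb1 hb3, ha, hb, ha3, hb3]
  · simp [ha1 ha3, hb2 hb3, ha, hb, hp, hq, ha3, hne.symm,
      eq_comm (a := F.root q) (b := F.root b), hb3]
  · simp [ha2 ha3, hb1 hb3, ha, hb, hp, hq, ha3, hb3, hne]
  · simp [ha2 ha3, hb2 hb3, ha, hb, ha3, eq_comm (a := F.root q) (b := F.root b), hb3]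

end Forest

/-! ## Fibre partitions -/

namespace Input

variable {D : Input A} {S : Set D.Item} {x y : ℝ} {p q r : A}

/-- With `I_{p,q}`, the family also contains `I_p` and `I_q`. -/
def Closed (D : Input A) (S : Set D.Item) : Prop :=
  ∀ e, Sum.inr e ∈ S → ∀ p ∈ e.1, Sum.inl p ∈ S

/-- `p` and `q` are glued at `x` by a member of the family. -/
def GluedAt (D : Input A) (S : Set D.Item) (x : ℝ) (p q : A) : Prop :=
  ∃ e : {e // e ∈ D.pairs}, Sum.inr e ∈ S ∧ e.1 = s(p, q) ∧ x ∈ D.glue e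

/-- `I_p` is a member of the family and contains `x`. -/
def Alive (D : Input A) (S : Set D.Item) (x : ℝ) (p : A) : Prop :=
  Sum.inl p ∈ S ∧ x ∈ D.ground p

theorem mem_ground_of_mem_glue {e : {e // e ∈ D.pairs}} (hp : p ∈ e.1) (hx : x ∈ D.glue e) :
    x ∈ D.ground p := by
  have h := NonemptyInterval.le_def.1 (D.glue_le e p hp)
  rw [NonemptyInterval.mem_def] at *
  exact ⟨h.1.trans hx.1, hx.2.trans h.2⟩

theorem SimAt.symm (h : D.SimAt S x p q) : D.SimAt S x q p := by
  obtain ⟨z, w, hz, hw, h⟩ := h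
  exact ⟨w, z, hw, hz, (D.gluing S).symm h⟩

theorem SimAt.trans (h : D.SimAt S x p q) (h' : D.SimAt S x q r) : D.SimAt S x p r := by
  obtain ⟨z, w, hz, hw, h⟩ := h
  obtain ⟨z', w', hz', hw', h'⟩ := h'
  obtain rfl : w = z' := Subtype.ext (hw.trans hz'.symm)
  exact ⟨z, w', hz, hw', (D.gluing S).trans h h'⟩

theorem isPartialEquiv_simAt : IsPartialEquiv (D.SimAt S x) := ⟨SimAt.symm, SimAt.trans⟩

theorem simAt_self : D.SimAt S x p p ↔ D.Alive S x p := by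
  constructor
  · rintro ⟨z, w, hz, -, -⟩
    have := z.2
    rw [hz] at this
    exact this
  · exact fun h => ⟨⟨(p, x), h⟩, ⟨(p, x), h⟩, rfl, rfl, (D.gluing S).refl _⟩

theorem simAt_of_gluedAt (hS : D.Closed S) (h : D.GluedAt S x p q) : D.SimAt S x p q := by
  obtain ⟨e, he, hpq, hx⟩ := h
  have hp : p ∈ e.1 := by simp [hpq]
  have hq : q ∈ e.1 := by simp [hpq]
  exact ⟨⟨(p, x), hS e he p hp, mem_ground_of_mem_glue hp hx⟩,
    ⟨(q, x), hS e he q hq, mem_ground_of_mem_glue hq hx⟩, rfl, rfl,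
    .rel _ _ ⟨rfl, e, he, hpq, hx⟩⟩

/-- Gluings never change the real coordinate, so the relation can be generated on `A` over a fixed
`x`. Closedness ensures that both ends of every gluing are points of the family. -/
theorem simAt_iff (hS : D.Closed S) :
    D.SimAt S x p q ↔ D.Alive S x p ∧ Relation.EqvGen (D.GluedAt S x) p q := by
  constructor
  · rintro ⟨z, w, hz, hw, h⟩
    refine ⟨simAt_self.1 ⟨z, z, hz, hz, (D.gluing S).refl _⟩, ?_⟩
    have key : ∀ z w : D.Point S, Relation.EqvGen (D.GlueRel S) z w →
        z.1.2 = w.1.2 ∧ Relation.EqvGen (D.GluedAt S z.1.2) z.1.1 w.1.1 := by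
      intro z w h
      induction h with
      | rel z w h => exact ⟨h.1, .rel _ _ h.2⟩
      | refl z => exact ⟨rfl, .refl _⟩
      | symm z w _ ih => exact ⟨ih.1.symm, ih.1 ▸ ih.2.symm⟩
      | trans z w v _ _ ih ih' =>
        exact ⟨ih.1.trans ih'.1, ih.2.trans _ _ _ (ih.1 ▸ ih'.2)⟩
    have := (key z w h).2
    rwa [hz, hw] at this
  · rintro ⟨hp, h⟩
    -- Aliveness is carried through the induction because symmetry and transitivity need it at the
    -- other and the intermediate element.
    have key : (D.Alive S x p ↔ D.Alive S x q) ∧ (D.Alive S x p → D.SimAt S x p q) := by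
      clear hp
      induction h with
      | rel p q h =>
        have := simAt_of_gluedAt hS h
        exact ⟨iff_of_true (simAt_self.1 (this.trans this.symm))
          (simAt_self.1 (this.symm.trans this)), fun _ => this⟩
      | refl p => exact ⟨Iff.rfl, simAt_self.2⟩
      | symm p q _ ih => exact ⟨ih.1.symm, fun h => (ih.2 (ih.1.2 h)).symm⟩
      | trans p q r _ _ ih ih' =>
        exact ⟨ih.1.trans ih'.1, fun h => (ih.2 h).trans (ih'.2 (ih.1.1 h))⟩
    exact key.2 hp

theorem fibrePartition_eq_classes : D.fibrePartition S x = classes (D.SimAt S x) := by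
  ext C
  simp only [fibrePartition, classes, simAt_self]
  rfl

theorem fibrePartition_eq_iff :
    D.fibrePartition S x = D.fibrePartition S y ↔ D.SimAt S x = D.SimAt S y := by
  rw [fibrePartition_eq_classes, fibrePartition_eq_classes]
  exact isPartialEquiv_simAt.classes_eq_iff isPartialEquiv_simAt

/-- To the right of all left endpoints, the fibre partitions only become finer and smaller. -/
theorem simAt_anti (hS : D.Closed S) {a : ℝ} (ha : ∀ i ∈ S, (D.interval i).fst ≤ a) (hax : a ≤ x)
    (hxy : x ≤ y) (h : D.SimAt S y p q) : D.SimAt S x p q := by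
  rw [simAt_iff hS] at *
  -- Every interval of the family that contains `y` contains `x`: on the left because its left
  -- endpoint is at most `a`, on the right because `x ≤ y`.
  refine ⟨⟨h.1.1, (ha _ h.1.1).trans hax, hxy.trans h.1.2.2⟩, ?_⟩
  refine Relation.EqvGen.mono ?_ _ _ h.2
  rintro p q ⟨e, he, hpq, hy⟩
  exact ⟨e, he, hpq, (ha _ he).trans hax, hxy.trans hy.2⟩

/-- In a closed family no gluing involves the absent `r`, so `r` enters as an isolated class. -/
theorem simAt_insert_inl (hS : D.Closed S) (hr : Sum.inl r ∉ S) :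
    D.SimAt (insert (Sum.inl r) S) x p q ↔
      D.SimAt S x p q ∨ (x ∈ D.ground r ∧ p = r ∧ q = r) := by
  have hS' : D.Closed (insert (Sum.inl r) S) := fun e he p hp =>
    .inr (hS e (by simpa using he) p hp)
  have hg : D.GluedAt (insert (Sum.inl r) S) x = D.GluedAt S x := by
    funext a b
    simp [GluedAt]
  have hr' : ∀ a b, Relation.EqvGen (D.GluedAt S x) a b → (a = r ↔ b = r) := by
    intro a b h
    induction h with
    | rel a b h =>
      obtain ⟨e, he, hab, -⟩ := h
      refine iff_of_false ?_ ?_ <;> rintro rfl <;> exact hr (hS e he _ (by simp [hab]))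
    | refl a => rfl
    | symm a b _ ih => exact ih.symm
    | trans a b c _ _ ih ih' => exact ih.trans ih'
  rw [simAt_iff hS, simAt_iff hS', hg]
  simp only [Alive, Set.mem_insert_iff, Sum.inl.injEq]
  constructor
  · rintro ⟨⟨rfl | h, hx⟩, h'⟩
    · exact .inr ⟨hx, rfl, (hr' _ _ h').1 rfl⟩
    · exact .inl ⟨⟨h, hx⟩, h'⟩
  · rintro (⟨⟨h, hx⟩, h'⟩ | ⟨hx, rfl, rfl⟩)
    · exact ⟨⟨.inr h, hx⟩, h'⟩
    · exact ⟨⟨.inl rfl, hx⟩, .refl _⟩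

theorem gluedAt_insert_inr {e : {e // e ∈ D.pairs}} :
    D.GluedAt (insert (Sum.inr e) S) x p q ↔
      D.GluedAt S x p q ∨ (e.1 = s(p, q) ∧ x ∈ D.glue e) := by
  simp only [GluedAt, Set.mem_insert_iff, Sum.inr.injEq]
  constructor
  · rintro ⟨f, rfl | hf, h⟩
    · exact .inr h
    · exact .inl ⟨f, hf, h⟩
  · rintro (⟨f, hf, h⟩ | h)
    · exact ⟨f, .inr hf, h⟩
    · exact ⟨e, .inl rfl, h⟩

theorem closed_insert_inr (hS : D.Closed S) {e : {e // e ∈ D.pairs}}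
    (he : ∀ p ∈ e.1, Sum.inl p ∈ S) : D.Closed (insert (Sum.inr e) S) := by
  intro f hf p hp
  rcases hf with hf | hf
  · obtain rfl := Sum.inr.inj hf
    exact .inr (he p hp)
  · exact .inr (hS f hf p hp)

theorem alive_insert_inr {e : {e // e ∈ D.pairs}} :
    D.Alive (insert (Sum.inr e) S) x p ↔ D.Alive S x p := by
  simp [Alive]

theorem simAt_insert_inr_of_notMem (hS : D.Closed S) {e : {e // e ∈ D.pairs}}
    (he : ∀ p ∈ e.1, Sum.inl p ∈ S) (hx : x ∉ D.glue e) :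
    D.SimAt (insert (Sum.inr e) S) x = D.SimAt S x := by
  have hg : D.GluedAt (insert (Sum.inr e) S) x = D.GluedAt S x := by
    funext a b
    simp [gluedAt_insert_inr, hx]
  funext a b
  rw [simAt_iff hS, simAt_iff (closed_insert_inr hS he), alive_insert_inr, hg]

/-- The only new generator over `x` joins `p` to `q`, both alive there, and `Unite` is closed under
symmetry and transitivity. -/
theorem simAt_insert_inr_of_mem (hS : D.Closed S) {e : {e // e ∈ D.pairs}}
    (he : ∀ p ∈ e.1, Sum.inl p ∈ S) (hx : x ∈ D.glue e) (hpq : e.1 = s(p, q)) :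
    D.SimAt (insert (Sum.inr e) S) x = Unite (D.SimAt S x) p q := by
  have hp : p ∈ e.1 := by simp [hpq]
  have hq : q ∈ e.1 := by simp [hpq]
  have hpp : D.SimAt S x p p := simAt_self.2 ⟨he p hp, mem_ground_of_mem_glue hp hx⟩
  have hqq : D.SimAt S x q q := simAt_self.2 ⟨he q hq, mem_ground_of_mem_glue hq hx⟩
  have hS' := closed_insert_inr hS he
  have symm : ∀ a b, D.SimAt S x a b → D.SimAt S x b a := fun _ _ => SimAt.symm
  have trans : ∀ a b c, D.SimAt S x a b → D.SimAt S x b c → D.SimAt S x a c :=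
    fun _ _ _ => SimAt.trans
  have mono : ∀ a b, D.SimAt S x a b → D.SimAt (insert (Sum.inr e) S) x a b := by
    intro a b h
    rw [simAt_iff hS] at h
    rw [simAt_iff hS', alive_insert_inr]
    exact ⟨h.1, Relation.EqvGen.mono (fun a b h => gluedAt_insert_inr.2 (.inl h)) _ _ h.2⟩
  have hpq' : D.SimAt (insert (Sum.inr e) S) x p q :=
    simAt_of_gluedAt hS' ⟨e, .inl rfl, hpq, hx⟩
  funext a b
  refine propext ⟨fun h => ?_, ?_⟩
  · rw [simAt_iff hS', alive_insert_inr] at h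
    have key : (D.Alive S x a ↔ D.Alive S x b) ∧
        (D.Alive S x a → Unite (D.SimAt S x) p q a b) := by
      replace h := h.2
      simp only [← simAt_self, Unite] at *
      induction h with
      | rel a b h =>
        rcases gluedAt_insert_inr.1 h with h | ⟨h, -⟩
        · have := simAt_of_gluedAt hS h
          grind
        · rw [hpq, Sym2.eq_iff] at h
          rcases h with ⟨rfl, rfl⟩ | ⟨rfl, rfl⟩
          · exact ⟨iff_of_true hpp hqq, fun _ => .inr (.inl ⟨hpp, hqq⟩)⟩
          · exact ⟨iff_of_true hqq hpp, fun _ => .inr (.inr ⟨hqq, hpp⟩)⟩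
      | refl a => exact ⟨Iff.rfl, .inl⟩
      | symm a b _ ih => grind
      | trans a b c _ _ ih ih' => grind
    exact key.2 h.1
  · rintro (h | ⟨h, h'⟩ | ⟨h, h'⟩)
    · exact mono _ _ h
    · exact (mono _ _ h).trans (hpq'.trans (mono _ _ h'))
    · exact (mono _ _ h).trans (hpq'.symm.trans (mono _ _ h'))

end Input

/-! ## Subdivisions of the line -/

/-- The graph from `J` to `J'` joins the roots of trees with a common vertex. -/
def Link (J J' : Entry A) : Prop :=
  ∀ x y, J.next x y ↔ ∃ c, J.uf.Stored c ∧ J'.uf.Stored c ∧ J.uf.root c = x ∧ J'.uf.root c = y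

/-- The entries form a subdivision of the line, listed from left to right, with well-formed
forests and correct graphs. -/
structure Subdivision (L : List (Entry A)) : Prop where
  below : L.Pairwise fun J J' => Below J.cell J'.cell
  link : L.IsChain Link
  nonempty : ∀ J ∈ L, J.cell.Nonempty
  wellFormed : ∀ J ∈ L, J.uf.WellFormed
  cover : ∀ x, ∃ J ∈ L, x ∈ J.cell

theorem isChain_replace {α : Type*} {R : α → α → Prop} {X Y M : List α} {a : α}
    (h : (X ++ a :: Y).IsChain R) (hM : M.IsChain R) (hne : M ≠ [])
    (hhead : ∀ b ∈ M.head?, ∀ c, R c a → R c b) (hlast : ∀ b ∈ M.getLast?, ∀ c, R a c → R b c) :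
    (X ++ M ++ Y).IsChain R := by
  rw [List.isChain_append, List.isChain_cons] at h
  obtain ⟨hX, ⟨haY, hY⟩, hXa⟩ := h
  rw [List.append_assoc, List.isChain_append, List.isChain_append]
  refine ⟨hX, ⟨hM, hY, fun b hb c hc => hlast b hb c (haY c hc)⟩, fun c hc b hb => ?_⟩
  rw [List.head?_append_of_ne_nil _ hne] at hb
  exact hhead b hb c (hXa c hc a rfl)

theorem Subdivision.replace {X Y M : List (Entry A)} {J : Entry A}
    (h : Subdivision (X ++ J :: Y)) (hbelow : M.Pairwise fun J J' => Below J.cell J'.cell)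
    (hlink : M.IsChain Link) (hne : M ≠ []) (hnonempty : ∀ K ∈ M, K.cell.Nonempty)
    (hcover : ∀ x ∈ J.cell, ∃ K ∈ M, x ∈ K.cell) (hsub : ∀ K ∈ M, K.cell ⊆ J.cell)
    (hsim : ∀ K ∈ M, K.uf.Similar J.uf) (hlast : ∀ K ∈ M.getLast?, K.next = J.next) :
    Subdivision (X ++ M ++ Y) where
  below := by
    have := h.below
    rw [List.pairwise_append, List.pairwise_cons] at this
    obtain ⟨hX, ⟨hJY, hY⟩, hXJ⟩ := this
    rw [List.append_assoc, List.pairwise_append, List.pairwise_append]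
    refine ⟨hX, ⟨hbelow, hY, fun K hK N hN x hx y hy => hJY N hN x (hsub K hK hx) y hy⟩, ?_⟩
    intro K hK N hN x hx y hy
    rcases List.mem_append.1 hN with hN | hN
    · exact hXJ K hK J (by simp) x hx y (hsub N hN hy)
    · exact hXJ K hK N (by simp [hN]) x hx y hy
  link := by
    refine isChain_replace h.link hlink hne (fun K hK N hN x y => ?_) fun K hK N hN x y => ?_
    · have hs := hsim K (List.mem_of_mem_head? hK)
      rw [hN x y]
      simp only [hs.stored, hs.root]
    · have hs := hsim K (List.mem_of_mem_getLast? hK)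
      rw [hlast K hK, hN x y]
      simp only [hs.stored, hs.root]
  nonempty K hK := by
    have := h.nonempty
    simp only [List.mem_append, List.mem_cons] at this hK
    grind
  wellFormed K hK := by
    have := h.wellFormed
    have hs := fun K hK => (hsim K hK).wellFormed
    simp only [List.mem_append, List.mem_cons] at this hK
    grind
  cover x := by
    obtain ⟨K, hK, hx⟩ := h.cover x
    simp only [List.mem_append, List.mem_cons] at hK ⊢
    rcases hK with hK | rfl | hK
    · exact ⟨K, .inl (.inl hK), hx⟩
    · obtain ⟨N, hN, hx⟩ := hcover x hx
      exact ⟨N, .inl (.inr hN), hx⟩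
    · exact ⟨K, .inr hK, hx⟩

/-- Modifying the entry `L`, and the graph from its predecessor to it. -/
theorem Subdivision.update {X Y : List (Entry A)} {L L' : Entry A} {f : Entry A → Entry A}
    (h : Subdivision (X.reverse ++ L :: Y)) (hcell : ∀ K, (f K).cell = K.cell)
    (huf : ∀ K, (f K).uf = K.uf) (hL : L'.cell = L.cell) (hwf : L'.uf.WellFormed)
    (hpred : ∀ K ∈ X.head?, Link K L → Link (f K) L')
    (hsucc : ∀ N ∈ Y.head?, Link L N → Link L' N) :
    Subdivision ((X.modifyHead f).reverse ++ L' :: Y) := by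
  cases X with
  | nil =>
    refine ⟨?_, ?_, ?_, ?_, fun x => ?_⟩
    · simpa [hL] using h.below
    · have := h.link
      simp only [List.reverse_nil, List.nil_append, List.isChain_cons] at this
      simp only [List.modifyHead_nil, List.reverse_nil, List.nil_append, List.isChain_cons]
      exact ⟨fun N hN => hsucc N hN (this.1 N hN), this.2⟩
    · simpa [hL] using h.nonempty
    · have := h.wellFormed
      simp at this
      simpa [hwf] using this.2
    · simpa [hL] using h.cover x
  | cons K X =>
    refine ⟨?_, ?_, ?_, ?_, fun x => ?_⟩
    · simpa [hL, hcell, List.pairwise_append] using h.below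
    · have := h.link
      simp only [List.reverse_cons, List.append_assoc, List.singleton_append] at this
      rw [List.isChain_append, List.isChain_cons, List.isChain_cons] at this
      obtain ⟨h1, ⟨h2, h3, h4⟩, h5⟩ := this
      simp only [List.modifyHead_cons, List.reverse_cons, List.append_assoc,
        List.singleton_append]
      rw [List.isChain_append, List.isChain_cons, List.isChain_cons]
      refine ⟨h1, ⟨?_, fun N hN => hsucc N hN (h3 N hN), h4⟩, ?_⟩
      · rintro _ ⟨⟩
        exact hpred K rfl (h2 L rfl)
      · rintro N hN _ ⟨⟩
        have := h5 N hN K rfl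
        unfold Link at this ⊢
        rwa [huf]
    · simpa [hL, hcell, or_imp, forall_and] using h.nonempty
    · have := h.wellFormed
      simp [or_imp, forall_and] at this
      simpa [hwf, huf, or_imp, forall_and] using ⟨this.1, this.2.1, this.2.2.2⟩
    · simpa [hL, hcell, or_and_right, exists_or] using h.cover x

/-- `K` and `L` have the same trees but possibly different roots. If two edges meet at a root of
`L`, the vertex shared by `L` and `N` lies in the same tree of `L`, hence of `K`, as the vertex
shared by `K` and `L`; so it also witnesses the composed edge. -/
theorem Link.comp {K L N : Entry A} (hKL : Link K L) (hLN : Link L N)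
    (hrel : L.uf.Rel = K.uf.Rel) {c : Set ℝ} :
    Link ⟨c, K.uf, Relation.Comp K.next L.next⟩ N := by
  have hst : ∀ a, L.uf.Stored a ↔ K.uf.Stored a := fun a => by
    rw [← Forest.rel_self, ← Forest.rel_self, hrel]
  intro x y
  simp only [Relation.Comp, hKL x, hLN _ y]
  constructor
  · rintro ⟨r, ⟨c, hc, hc', rfl, rfl⟩, d, hd, hd', h, rfl⟩
    have : K.uf.Rel d c := hrel ▸ Forest.rel_iff.2 ⟨hd, hc', h⟩
    exact ⟨d, (hst d).1 hd, hd', (Forest.rel_iff.1 this).2.2, rfl⟩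
  · rintro ⟨c, hc, hc', rfl, rfl⟩
    exact ⟨_, ⟨c, hc, (hst c).2 hc, rfl, rfl⟩, c, (hst c).2 hc, hc', rfl, rfl⟩

theorem Subdivision.merge {X Y : List (Entry A)} {K L : Entry A}
    (h : Subdivision (X ++ K :: L :: Y)) (hrel : L.uf.Rel = K.uf.Rel) :
    Subdivision (X ++ ⟨K.cell ∪ L.cell, K.uf, Relation.Comp K.next L.next⟩ :: Y) where
  below := by
    have := h.below
    simp only [List.pairwise_append, List.pairwise_cons, List.mem_cons] at this ⊢
    obtain ⟨h1, ⟨h2, h3, h4⟩, h5⟩ := this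
    refine ⟨h1, ⟨?_, h4⟩, ?_⟩
    · rintro N hN x (hx | hx)
      · exact h2 N (.inr hN) x hx
      · exact h3 N hN x hx
    · rintro N hN M (rfl | hM) x hx y hy
      · rcases hy with hy | hy
        · exact h5 N hN K (.inl rfl) x hx y hy
        · exact h5 N hN L (.inr (.inl rfl)) x hx y hy
      · exact h5 N hN M (.inr (.inr hM)) x hx y hy
  link := by
    have := h.link
    rw [List.isChain_append, List.isChain_cons, List.isChain_cons] at this
    obtain ⟨h1, ⟨h2, h3, h4⟩, h5⟩ := this
    rw [List.isChain_append, List.isChain_cons]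
    refine ⟨h1, ⟨fun N hN => (h2 L rfl).comp (h3 N hN) hrel, h4⟩, ?_⟩
    rintro N hN _ ⟨⟩
    exact h5 N hN K rfl
  nonempty M hM := by
    rcases List.mem_append.1 hM with hM | hM
    · exact h.nonempty M (by simp [hM])
    · rcases List.mem_cons.1 hM with rfl | hM
      · exact (h.nonempty K (by simp)).inl
      · exact h.nonempty M (by simp [hM])
  wellFormed M hM := by
    rcases List.mem_append.1 hM with hM | hM
    · exact h.wellFormed M (by simp [hM])
    · rcases List.mem_cons.1 hM with rfl | hM
      · exact h.wellFormed K (by simp)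
      · exact h.wellFormed M (by simp [hM])
  cover x := by
    obtain ⟨M, hM, hx⟩ := h.cover x
    simp only [List.mem_append, List.mem_cons] at hM ⊢
    rcases hM with hM | rfl | rfl | hM
    · exact ⟨M, .inl hM, hx⟩
    · exact ⟨_, .inr (.inl rfl), .inl hx⟩
    · exact ⟨_, .inr (.inl rfl), .inr hx⟩
    · exact ⟨M, .inr (.inr hM), hx⟩

/-! ### Splitting -/

/-- `J` is subdivided into `L`, which lies in `I`, and the entries of `lo` and `hi`, which lie
to the left and to the right of `I`. -/
structure IsSplit (J : Entry A) (I : Set ℝ) (lo : List (Entry A)) (L : Entry A)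
    (hi : List (Entry A)) : Prop where
  cell_eq : L.cell = J.cell ∩ I
  lo_length : lo = [] ∨ ∃ K, lo = [K]
  hi_length : hi = [] ∨ ∃ K, hi = [K]
  lo_below : ∀ K ∈ lo, Below K.cell I
  hi_above : ∀ K ∈ hi, Below I K.cell
  link : (lo ++ L :: hi).IsChain Link
  nonempty : ∀ K ∈ lo ++ L :: hi, K.cell.Nonempty
  cover : ∀ x ∈ J.cell, ∃ K ∈ lo ++ L :: hi, x ∈ K.cell
  subset : ∀ K ∈ lo ++ L :: hi, K.cell ⊆ J.cell
  similar : ∀ K ∈ lo ++ L :: hi, K.uf.Similar J.uf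
  next_eq : ∀ K ∈ (lo ++ L :: hi).getLast?, K.next = J.next

theorem IsSplit.below {J : Entry A} {I : Set ℝ} {lo : List (Entry A)} {L : Entry A}
    {hi : List (Entry A)} (h : IsSplit J I lo L hi) :
    (lo ++ L :: hi).Pairwise fun J J' => Below J.cell J'.cell := by
  have hL : ∀ x ∈ L.cell, x ∈ I := fun x hx => (h.cell_eq ▸ hx : x ∈ J.cell ∩ I).2
  obtain ⟨z, hz⟩ := h.nonempty L (by simp)
  have hzI := hL z hz
  have hlo := h.lo_below
  have hhi := h.hi_above
  have h1 : lo.Pairwise fun J J' => Below J.cell J'.cell := by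
    rcases h.lo_length with h | ⟨K, h⟩ <;> simp [h]
  have h2 : hi.Pairwise fun J J' => Below J.cell J'.cell := by
    rcases h.hi_length with h | ⟨K, h⟩ <;> simp [h]
  rw [List.pairwise_append, List.pairwise_cons]
  refine ⟨h1, ⟨fun K hK x hx y hy => hhi K hK x (hL x hx) y hy, h2⟩, fun K hK N hN x hx y hy => ?_⟩
  rcases List.mem_cons.1 hN with rfl | hN
  · exact hlo K hK x hx y (hL y hy)
  · exact (hlo K hK x hx z hzI).trans (hhi N hN z hzI y hy)

theorem isSplit_split [Fintype A] {J : Entry A} {I : Set ℝ} [I.OrdConnected]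
    (hJ : J.uf.WellFormed) (hne : (J.cell ∩ I).Nonempty) :
    IsSplit J I (split J I).1 (split J I).2.1 (split J I).2.2 := by
  have hs := hJ.compressAll_similar
  have hid : ∀ x y, (x = y ∧ J.uf.compressAll.IsRoot x) ↔ ∃ c, J.uf.compressAll.Stored c ∧
      J.uf.compressAll.Stored c ∧ J.uf.compressAll.root c = x ∧ J.uf.compressAll.root c = y := by
    intro x y
    constructor
    · rintro ⟨rfl, hx⟩
      exact ⟨x, hx.stored, hx.stored, hx.root_eq, hx.root_eq⟩
    · rintro ⟨c, hc, -, rfl, rfl⟩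
      exact ⟨rfl, hs.wellFormed.isRoot_root hc⟩
  -- By convexity of `I`, no point outside it has points of `I` on both sides, so the three parts
  -- cover `J`.
  have htri : ∀ x ∉ I, Below {x} I ∨ Below I {x} := by
    intro x hx
    by_contra! h
    simp only [Below, Set.mem_singleton_iff, forall_eq, not_forall, not_lt] at h
    obtain ⟨⟨y, hy, hyx⟩, z, hz, hxz⟩ := h
    exact hx (Set.OrdConnected.out ‹_› hy hz ⟨hyx, hxz⟩)
  by_cases hJI : J.cell ⊆ I
  · simp only [split, if_pos hJI]
    have hne' := hne.mono Set.inter_subset_left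
    refine ⟨(Set.inter_eq_left.2 hJI).symm, .inl rfl, .inl rfl, ?_, ?_, ?_, ?_, ?_, ?_, ?_, ?_⟩ <;>
      simp [hne', Forest.Similar.refl hJ]
  · simp only [split, if_neg hJI]
    have hcover : ∀ x ∈ J.cell, (x ∈ J.cell ∧ Below {x} I) ∨ (x ∈ J.cell ∧ x ∈ I) ∨
        (x ∈ J.cell ∧ Below I {x}) := by
      intro x hx
      have := htri x
      tauto
    by_cases h1 : {x | x ∈ J.cell ∧ Below {x} I}.Nonempty <;>
    by_cases h2 : {x | x ∈ J.cell ∧ Below I {x}}.Nonempty <;>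
    simp only [h1, h2, if_true, if_false]
    · refine ⟨rfl, .inr ⟨_, rfl⟩, .inr ⟨_, rfl⟩, ?_, ?_, ?_, ?_, ?_, ?_, ?_, ?_⟩
      · simp [Below]
      · simp +contextual [Below]
      · simp [Link, hid]
      · simpa [hne] using ⟨h1, h2⟩
      · simpa using hcover
      · simp +contextual [Set.subset_def]
      · simp [hs]
      · simp
    · refine ⟨rfl, .inr ⟨_, rfl⟩, .inl rfl, ?_, ?_, ?_, ?_, ?_, ?_, ?_, ?_⟩
      · simp [Below]
      · simp
      · simp [Link, hid]
      · simpa [hne] using h1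
      · rw [Set.not_nonempty_iff_eq_empty, Set.eq_empty_iff_forall_notMem] at h2
        intro x hx
        have := hcover x hx
        have := h2 x
        simp at this ⊢
        tauto
      · simp +contextual [Set.subset_def]
      · simp [hs]
      · simp
    · refine ⟨rfl, .inl rfl, .inr ⟨_, rfl⟩, ?_, ?_, ?_, ?_, ?_, ?_, ?_, ?_⟩
      · simp
      · simp +contextual [Below]
      · simp [Link, hid]
      · simpa [hne] using h2
      · rw [Set.not_nonempty_iff_eq_empty, Set.eq_empty_iff_forall_notMem] at h1
        intro x hx
        have := hcover x hx
        have := h1 x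
        simp at this ⊢
        tauto
      · simp +contextual [Set.subset_def]
      · simp [hs]
      · simp
    · refine ⟨rfl, .inl rfl, .inl rfl, ?_, ?_, ?_, ?_, ?_, ?_, ?_, ?_⟩
      · simp
      · simp
      · simp
      · simpa using hne
      · rw [Set.not_nonempty_iff_eq_empty, Set.eq_empty_iff_forall_notMem] at h1 h2
        intro x hx
        have := hcover x hx
        have := h1 x
        have := h2 x
        simp at *
        tauto
      · simp
      · simp [hs]
      · simp

theorem Subdivision.split {X Y lo hi : List (Entry A)} {J L : Entry A} {I : Set ℝ}
    (h : Subdivision (X.reverse ++ J :: Y)) (hs : IsSplit J I lo L hi) :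
    Subdivision ((lo ++ X).reverse ++ L :: (hi ++ Y)) := by
  have := h.replace hs.below hs.link (by simp) hs.nonempty hs.cover hs.subset hs.similar hs.next_eq
  have hrev : lo.reverse = lo := by rcases hs.lo_length with h | ⟨K, h⟩ <;> simp [h]
  simpa [hrev] using this

/-! ### Distinct neighbours -/

/-- Here `j` is the relation of the cell being split and `u` that of its changed middle part; the
outer parts keep `j`. A comparison with an old neighbour is needed only on a side where no outer
part remains. -/
theorem isChain_ne_refine {α : Type*} {X Y lo hi : List α} {j u : α}
    (h : (X ++ j :: Y).IsChain (· ≠ ·)) (hu : u ≠ j) (hlo : lo = [] ∨ lo = [j])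
    (hhi : hi = [] ∨ hi = [j]) (hpred : lo = [] → ∀ k ∈ X.getLast?, k ≠ u)
    (hsucc : hi = [] → ∀ n ∈ Y.head?, u ≠ n) :
    (X ++ lo ++ u :: (hi ++ Y)).IsChain (· ≠ ·) := by
  rw [List.isChain_append, List.isChain_cons] at h
  obtain ⟨hX, ⟨hjY, hY⟩, hXj⟩ := h
  have h1 : (X ++ lo).IsChain (· ≠ ·) ∧ ∀ k ∈ (X ++ lo).getLast?, k ≠ u := by
    rcases hlo with rfl | rfl
    · simpa [hX] using hpred rfl
    · rw [List.isChain_append]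
      exact ⟨⟨hX, List.isChain_singleton _, by simpa using hXj⟩, by simpa using hu.symm⟩
  have h2 : (hi ++ Y).IsChain (· ≠ ·) ∧ ∀ n ∈ (hi ++ Y).head?, u ≠ n := by
    rcases hhi with rfl | rfl
    · simpa [hY] using hsucc rfl
    · rw [List.singleton_append, List.isChain_cons]
      exact ⟨⟨hjY, hY⟩, by simpa using hu⟩
  rw [List.isChain_append, List.isChain_cons]
  refine ⟨h1.1, ⟨h2.2, h2.1⟩, ?_⟩
  rintro k hk _ ⟨⟩
  exact h1.2 k hk

/-- The predecessor, with relation `u`, has absorbed the middle part. A surviving right part carries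
`j`, already known to differ from `u`. -/
theorem isChain_ne_merge {α : Type*} {X Y hi : List α} {j u : α}
    (h : (X ++ u :: j :: Y).IsChain (· ≠ ·)) (hhi : hi = [] ∨ hi = [j])
    (hsucc : hi = [] → ∀ n ∈ Y.head?, u ≠ n) : (X ++ u :: (hi ++ Y)).IsChain (· ≠ ·) := by
  rcases hhi with rfl | rfl
  · rw [List.isChain_append, List.isChain_cons, List.isChain_cons] at h
    rw [List.isChain_append, List.isChain_cons]
    exact ⟨h.1, ⟨hsucc rfl, h.2.1.2.2⟩, by simpa using h.2.2⟩
  · exact h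

theorem mem_modifyHead {X : List (Entry A)} {f : Entry A → Entry A}
    (hcell : ∀ K, (f K).cell = K.cell) (huf : ∀ K, (f K).uf = K.uf) {K : Entry A}
    (hK : K ∈ X.modifyHead f) : ∃ N ∈ X, K.cell = N.cell ∧ K.uf = N.uf := by
  cases X with
  | nil => simp at hK
  | cons N X =>
    rcases List.mem_cons.1 hK with rfl | hK
    · exact ⟨N, by simp, hcell N, huf N⟩
    · exact ⟨K, by simp [hK], rfl, rfl⟩

theorem map_rel_modifyHead {X : List (Entry A)} {f : Entry A → Entry A}
    (huf : ∀ K, (f K).uf = K.uf) :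
    (X.modifyHead f).map (fun K => K.uf.Rel) = X.map (fun K => K.uf.Rel) := by
  cases X <;> simp [huf]

theorem foldl_induction {α β : Type*} {P : β → List α → Prop} {f : β → α → β}
    (step : ∀ b a l, P b (a :: l) → P (f b a) l) {b : β} {l : List α} (h : P b l) :
    P (l.foldl f b) [] := by
  induction l generalizing b with
  | nil => exact h
  | cons a l ih => exact ih (step _ _ _ h)

/-! ## The inner loops -/

variable {D : Input A} {S S' : Set D.Item}

/-- The list of entries is correct for the family `S`. -/
structure Correct (D : Input A) (S : Set D.Item) (L : List (Entry A)) : Prop where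
  subdivision : Subdivision L
  rel_eq : ∀ J ∈ L, ∀ x ∈ J.cell, J.uf.Rel = D.SimAt S x
  distinct : (L.map fun J => J.uf.Rel).IsChain (· ≠ ·)

/-- The entries of `done` (nearest first) have been updated from the family `S` to the family
`S'`, and those of `rest` have not. -/
structure Progress (D : Input A) (S S' : Set D.Item) (done rest : List (Entry A)) : Prop where
  subdivision : Subdivision (done.reverse ++ rest)
  done_rel : ∀ J ∈ done, ∀ x ∈ J.cell, J.uf.Rel = D.SimAt S' x
  rest_rel : ∀ J ∈ rest, ∀ x ∈ J.cell, J.uf.Rel = D.SimAt S x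
  distinct : ((done.reverse ++ rest).map fun J => J.uf.Rel).IsChain (· ≠ ·)

theorem Correct.progress {L : List (Entry A)} (h : Correct D S L) : Progress D S S' [] L :=
  ⟨by simpa using h.subdivision, by simp, h.rel_eq, by simpa using h.distinct⟩

theorem Progress.correct {L : List (Entry A)} (h : Progress D S S' L []) :
    Correct D S' L.reverse :=
  ⟨by simpa using h.subdivision, by simpa using h.done_rel, by simpa using h.distinct⟩

section Progress

variable {done rest : List (Entry A)} {J : Entry A}

theorem Progress.wellFormed (h : Progress D S S' done (J :: rest)) : J.uf.WellFormed :=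
  h.subdivision.wellFormed J (by simp)

theorem Progress.nonempty (h : Progress D S S' done (J :: rest)) : J.cell.Nonempty :=
  h.subdivision.nonempty J (by simp)

theorem Progress.below (h : Progress D S S' done (J :: rest)) {N : Entry A} (hN : N ∈ rest) :
    Below J.cell N.cell := by
  have := h.subdivision.below
  rw [List.pairwise_append, List.pairwise_cons] at this
  exact this.2.1.1 N hN

theorem Progress.ne_head (h : Progress D S S' done (J :: rest)) {N : Entry A}
    (hN : N ∈ rest.head?) : J.uf.Rel ≠ N.uf.Rel := by
  have := h.distinct
  rw [List.map_append, List.map_cons, List.isChain_append, List.isChain_cons] at this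
  exact this.2.1.1 _ (by rw [List.head?_map]; exact Option.mem_map_of_mem _ hN)

/-- Moving on past an entry that need not be changed. -/
theorem Progress.skip (h : Progress D S S' done (J :: rest))
    (hJ : ∀ x ∈ J.cell, D.SimAt S' x = D.SimAt S x) : Progress D S S' (J :: done) rest where
  subdivision := by simpa using h.subdivision
  done_rel K hK x hx := by
    rcases List.mem_cons.1 hK with rfl | hK
    · rw [hJ x hx, h.rest_rel K (by simp) x hx]
    · exact h.done_rel K hK x hx
  rest_rel K hK := h.rest_rel K (by simp [hK])
  distinct := by simpa using h.distinct

theorem Progress.congr_uf (h : Progress D S S' done (J :: rest)) {F : Forest A}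
    (hF : F.Similar J.uf) : Progress D S S' done ({ J with uf := F } :: rest) where
  subdivision := by
    have := h.subdivision.replace (M := [{ J with uf := F }]) (by simp) (by simp) (by simp)
      (by simpa using h.nonempty) (by simp) (by simp) (by simpa using hF) (by simp)
    simpa using this
  done_rel := h.done_rel
  rest_rel K hK x hx := by
    rcases List.mem_cons.1 hK with rfl | hK
    · exact hF.rel_eq.trans (h.rest_rel J (by simp) x hx)
    · exact h.rest_rel K (by simp [hK]) x hx
  distinct := by
    have := h.distinct
    simp only [List.map_append, List.map_cons, hF.rel_eq] at this ⊢
    exact this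

/-- Splitting the entry `J`, and changing its part `L` to `L'`. -/
theorem Progress.split_update {I : Set ℝ} {lo hi : List (Entry A)} {L L' : Entry A}
    {f : Entry A → Entry A} (h : Progress D S S' done (J :: rest)) (hs : IsSplit J I lo L hi)
    (hout : ∀ x ∉ I, D.SimAt S' x = D.SimAt S x) (hcell : ∀ K, (f K).cell = K.cell)
    (huf : ∀ K, (f K).uf = K.uf) (hL : L'.cell = L.cell) (hwf : L'.uf.WellFormed)
    (hrel : ∀ x ∈ L'.cell, L'.uf.Rel = D.SimAt S' x) (hne : L'.uf.Rel ≠ J.uf.Rel)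
    (hpred : ∀ K ∈ (lo ++ done).head?, Link K L → Link (f K) L')
    (hsucc : ∀ N ∈ (hi ++ rest).head?, Link L N → Link L' N)
    (hsuccne : hi = [] → ∀ N ∈ rest.head?, L'.uf.Rel ≠ N.uf.Rel) :
    ((lo = [] → ∀ K ∈ done.head?, K.uf.Rel ≠ L'.uf.Rel) →
      Progress D S S' (hi ++ L' :: (lo ++ done).modifyHead f) rest) ∧
    (∀ K X, (lo ++ done).modifyHead f = K :: X → L'.uf.Rel = K.uf.Rel →
      Progress D S S' (hi ++ ⟨K.cell ∪ L'.cell, K.uf, Relation.Comp K.next L'.next⟩ :: X) rest) := by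
  have hhi : hi.reverse = hi := by rcases hs.hi_length with h | ⟨K, h⟩ <;> simp [h]
  have hmap : ∀ l : List (Entry A), (∀ K ∈ l, K.uf.Similar J.uf) → (l = [] ∨ ∃ K, l = [K]) →
      (l.map fun K => K.uf.Rel) = [] ∨ (l.map fun K => K.uf.Rel) = [J.uf.Rel] := by
    rintro l hl (rfl | ⟨K, rfl⟩)
    · simp
    · simp [(hl K (by simp)).rel_eq]
  have hlo1 := hmap lo (fun K hK => hs.similar K (by simp [hK])) hs.lo_length
  have hhi1 := hmap hi (fun K hK => hs.similar K (by simp [hK])) hs.hi_length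
  have hsub : Subdivision (((lo ++ done).modifyHead f).reverse ++ L' :: (hi ++ rest)) :=
    (h.subdivision.split hs).update hcell huf hL hwf hpred hsucc
  have hout' : ∀ K ∈ lo ++ L :: hi, (∀ x ∈ K.cell, x ∉ I) → ∀ x ∈ K.cell,
      K.uf.Rel = D.SimAt S' x := by
    intro K hK hKI x hx
    rw [hout x (hKI x hx), (hs.similar K hK).rel_eq]
    exact h.rest_rel J (by simp) x (hs.subset K hK hx)
  have hdone : ∀ K ∈ hi ++ L' :: (lo ++ done).modifyHead f, ∀ x ∈ K.cell,
      K.uf.Rel = D.SimAt S' x := by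
    intro K hK
    rcases List.mem_append.1 hK with hK | hK
    · exact hout' K (by simp [hK]) fun x hx hxI => lt_irrefl x (hs.hi_above K hK x hxI x hx)
    rcases List.mem_cons.1 hK with rfl | hK
    · exact hrel
    · obtain ⟨N, hN, hNc, hNu⟩ := mem_modifyHead hcell huf hK
      rw [hNc, hNu]
      rcases List.mem_append.1 hN with hN | hN
      · exact hout' N (by simp [hN]) fun x hx hxI => lt_irrefl x (hs.lo_below N hN x hx x hxI)
      · exact h.done_rel N hN
  have hrest : ∀ K ∈ rest, ∀ x ∈ K.cell, K.uf.Rel = D.SimAt S x := fun K hK =>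
    h.rest_rel K (by simp [hK])
  have hdist := h.distinct
  rw [List.map_append, List.map_cons] at hdist
  have hlorev : lo.reverse = lo := by rcases hs.lo_length with h | ⟨K, h⟩ <;> simp [h]
  have hsucc' : (hi.map fun K => K.uf.Rel) = [] →
      ∀ n ∈ (rest.map fun K => K.uf.Rel).head?, L'.uf.Rel ≠ n := by
    intro hhi0 n hn
    rw [List.head?_map, Option.mem_map] at hn
    obtain ⟨N, hN, rfl⟩ := hn
    exact hsuccne (List.map_eq_nil_iff.1 hhi0) N hN
  refine ⟨fun hlo => ⟨?_, hdone, hrest, ?_⟩, fun K X hX hKL => ?_⟩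
  · simpa [hhi] using hsub
  · have := isChain_ne_refine hdist hne hlo1 hhi1 (fun hlo0 k hk => ?_) hsucc'
    · rw [List.map_append, List.map_reverse, List.map_append, List.map_cons,
        map_rel_modifyHead huf, List.map_append, List.reverse_append, List.reverse_cons,
        List.reverse_append, ← List.map_reverse, ← List.map_reverse, ← List.map_reverse, hhi,
        hlorev]
      simpa using this
    · rw [List.map_reverse, List.getLast?_reverse, List.head?_map, Option.mem_map] at hk
      obtain ⟨K, hK, rfl⟩ := hk
      exact hlo (List.map_eq_nil_iff.1 hlo0) K hK
  · rw [hX] at hsub hdone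
    -- A nonempty left part is a copy of `J` and so differs from `L'`; a merge can only go into an
    -- entry of `done`.
    have hlo0 : lo = [] := by
      rcases hs.lo_length with h | ⟨N, rfl⟩
      · exact h
      · obtain ⟨rfl, -⟩ : f N = K ∧ done = X := by simpa using hX
        rw [huf, (hs.similar N (by simp)).rel_eq] at hKL
        exact absurd hKL hne
    subst hlo0
    refine ⟨?_, ?_, hrest, ?_⟩
    · have := Subdivision.merge (X := X.reverse) (Y := hi ++ rest) (by simpa using hsub) hKL
      simpa [hhi] using this
    · intro M hM
      rcases List.mem_append.1 hM with hM | hM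
      · exact hdone M (by simp [hM])
      rcases List.mem_cons.1 hM with rfl | hM
      · rintro x (hx | hx)
        · exact hdone K (by simp) x hx
        · exact hKL.symm.trans (hrel x hx)
      · exact hdone M (by simp [hM])
    · have hmapX : (done.map fun J => J.uf.Rel) = K.uf.Rel :: X.map fun J => J.uf.Rel := by
        have := map_rel_modifyHead (X := [] ++ done) huf
        rw [hX] at this
        simpa using this.symm
      rw [List.map_reverse, hmapX, List.reverse_cons, List.append_assoc, List.singleton_append,
        ← hKL] at hdist
      have := isChain_ne_merge hdist hhi1 hsucc'
      simpa [hhi, hKL] using this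

end Progress

/-! ### Intervals `I_p` -/

/-- The only possible new common vertex is `p`. It is a root of the new one-vertex tree, and `hK`
makes it a root on the left as well. -/
theorem Link.addSelfEdge {p : A} {K L : Entry A} (h : Link K L) (hL : ¬ L.uf.Stored p)
    (hK : K.uf.Stored p → K.uf.root p = p) :
    Link (addSelfEdge p K) { L with uf := L.uf.makeSet p } := by
  intro x y
  simp only [ReebAlg.addSelfEdge, Forest.stored_makeSet, Forest.root_makeSet hL, h x y]
  constructor
  · rintro (⟨c, hc, hc', h⟩ | ⟨hp, rfl, rfl⟩)
    · exact ⟨c, hc, .inl hc', h⟩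
    · exact ⟨_, hp, .inr rfl, hK hp, Forest.root_of_not_stored hL⟩
  · rintro ⟨c, hc, hc' | rfl, h, h'⟩
    · exact .inl ⟨c, hc, hc', h, h'⟩
    · exact .inr ⟨hc, h.symm.trans (hK hc), h'.symm.trans (Forest.root_of_not_stored hL)⟩

theorem Link.makeSet {p : A} {L N : Entry A} (h : Link L N) (hL : ¬ L.uf.Stored p)
    (hN : ¬ N.uf.Stored p) : Link { L with uf := L.uf.makeSet p } N := by
  intro x y
  simp only [Forest.stored_makeSet, Forest.root_makeSet hL, h x y]
  refine exists_congr fun c => ⟨fun hc => ⟨.inl hc.1, hc.2⟩, ?_⟩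
  rintro ⟨hc | rfl, hc', h⟩
  · exact ⟨hc, hc', h⟩
  · exact absurd hc' hN

/-- The state of the inner loop for `I_p`. -/
structure GroundInv (D : Input A) (S S' : Set D.Item) (done rest : List (Entry A)) : Prop where
  progress : Progress D S S' done rest
  ne : ∀ K ∈ done.head?, ∀ N ∈ rest.head?, ∀ x ∈ K.cell, ∀ y ∈ N.cell,
    D.SimAt S x ≠ D.SimAt S y

theorem GroundInv.visitGround [Fintype A] {p : A} {done rest : List (Entry A)} {J : Entry A}
    (hS : D.Closed S) (hpS : Sum.inl p ∉ S)
    (h : GroundInv D S (insert (Sum.inl p) S) done (J :: rest)) :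
    GroundInv D S (insert (Sum.inl p) S) (visitGround p (D.ground p : Set ℝ) done J) rest := by
  have hin : ∀ x ∈ D.ground p, D.SimAt (insert (Sum.inl p) S) x = AddPoint (D.SimAt S x) p := by
    intro x hx
    funext a b
    simp [Input.simAt_insert_inl hS hpS, AddPoint, hx]
  have hout : ∀ x ∉ (D.ground p : Set ℝ), D.SimAt (insert (Sum.inl p) S) x = D.SimAt S x := by
    intro x hx
    have hx' : x ∉ D.ground p := hx
    funext a b
    simp [Input.simAt_insert_inl hS hpS, hx']
  have hnp : ∀ x b, ¬ D.SimAt S x p b := fun x b hb =>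
    hpS (Input.simAt_self.1 (hb.trans hb.symm)).1
  have hrest : ∀ N ∈ J :: rest, ¬ N.uf.Stored p := by
    intro N hN hp
    obtain ⟨x, hx⟩ := h.progress.subdivision.nonempty N (by simp [List.mem_cons.1 hN])
    rw [← Forest.rel_self, h.progress.rest_rel N hN x hx] at hp
    exact hnp x p hp
  have hne : ∀ x ∈ J.cell, ∀ N ∈ rest.head?, ∀ y ∈ N.cell, D.SimAt S x ≠ D.SimAt S y := by
    intro x hx N hN y hy
    rw [← h.progress.rest_rel J (by simp) x hx,
      ← h.progress.rest_rel N (by simp [List.mem_of_mem_head? hN]) y hy]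
    exact h.progress.ne_head hN
  unfold ReebAlg.visitGround
  split_ifs with hJ
  swap
  · refine ⟨h.progress.skip fun x hx => hout x fun hxI => hJ ⟨x, hx, hxI⟩, ?_⟩
    rintro _ ⟨⟩ N hN x hx
    exact hne x hx N hN
  have : (D.ground p : Set ℝ).OrdConnected := by
    rw [NonemptyInterval.coe_def]; exact Set.ordConnected_Icc
  have hs := isSplit_split h.progress.wellFormed hJ
  dsimp only
  generalize (split J (D.ground p)).1 = lo at *
  generalize (split J (D.ground p)).2.1 = L at *
  generalize (split J (D.ground p)).2.2 = hi at *
  have hLs := hs.similar L (by simp)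
  have hLp : ¬ L.uf.Stored p := fun hp => hrest J (by simp) ((hLs.stored p).1 hp)
  have hLr : (L.uf.makeSet p).Rel = AddPoint J.uf.Rel p := by
    rw [hLs.wellFormed.rel_makeSet hLp, hLs.rel_eq]
  have hLpp : (L.uf.makeSet p).Rel p p := by
    rw [hLr]; exact .inr ⟨rfl, rfl⟩
  have hLJ : ∀ x ∈ L.cell, x ∈ J.cell ∧ x ∈ D.ground p := fun x hx =>
    (hs.cell_eq ▸ hx : x ∈ J.cell ∩ _)
  have hu := h.progress.split_update (f := addSelfEdge p)
    (L' := { L with uf := L.uf.makeSet p }) hs hout (fun _ => rfl) (fun _ => rfl) rfl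
    (hLs.wellFormed.makeSet hLp) (fun x hx => ?_) (fun he => ?_) (fun K hK hKL => ?_)
    (fun N hN hLN => ?_) (fun _ N hN he => ?_)
  · refine ⟨hu.1 fun _ K hK he => ?_, fun K hK N hN x hx => ?_⟩
    · obtain ⟨x, hx⟩ := h.progress.subdivision.nonempty K
        (by simp [List.mem_of_mem_head? hK])
      obtain ⟨y, hy⟩ := h.progress.nonempty
      have hKr := h.progress.done_rel K (List.mem_of_mem_head? hK) x hx
      -- If the predecessor lies over $I_p$ at `x`, both relations gained the singleton `p` and
      -- injectivity applies; otherwise only `L` stores `p`.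
      dsimp only at he
      by_cases hxI : x ∈ D.ground p
      · rw [hKr, hin x hxI, hLr, h.progress.rest_rel J (by simp) y hy] at he
        exact h.ne K hK J rfl x hx y hy (addPoint_injective (hnp x) (hnp y) he)
      · rw [hKr, hout x hxI] at he
        exact hnp x p (he ▸ hLpp)
    · refine hne x ?_ N hN
      rcases hs.hi_length with rfl | ⟨M, rfl⟩
      · obtain rfl : _ = K := by simpa using hK
        exact (hLJ x hx).1
      · obtain rfl : _ = K := by simpa using hK
        exact hs.subset _ (by simp) hx
  · dsimp only at hx ⊢
    rw [hLr, hin x (hLJ x hx).2, h.progress.rest_rel J (by simp) x (hLJ x hx).1]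
  · dsimp only at he
    rw [he] at hLpp
    exact hrest J (by simp) hLpp.1
  · refine hKL.addSelfEdge hLp fun hKp => ?_
    rcases List.mem_append.1 (List.mem_of_mem_head? hK) with hK | hK
    · exact absurd (((hs.similar K (by simp [hK])).stored p).1 hKp) (hrest J (by simp))
    · obtain ⟨x, hx⟩ := h.progress.subdivision.nonempty K (by simp [hK])
      have hwf := h.progress.subdivision.wellFormed K (by simp [hK])
      have hr := hwf.isRoot_root hKp
      have : K.uf.Rel p (K.uf.root p) := Forest.rel_iff.2 ⟨hKp, hr.stored, hr.root_eq.symm⟩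
      rw [h.progress.done_rel K hK x hx, Input.simAt_insert_inl hS hpS] at this
      rcases this with h | h
      · exact absurd h (hnp _ _)
      · exact h.2.2
  · refine hLN.makeSet hLp fun hNp => ?_
    rcases List.mem_append.1 (List.mem_of_mem_head? hN) with hN | hN
    · exact hrest J (by simp) (((hs.similar N (by simp [hN])).stored p).1 hNp)
    · exact hrest N (by simp [hN]) hNp
  · dsimp only at he
    rw [he] at hLpp
    exact hrest N (by simp [List.mem_of_mem_head? hN]) hLpp.1

theorem Correct.step_inl [Fintype A] {p : A} {L : List (Entry A)} (hS : D.Closed S)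
    (hpS : Sum.inl p ∉ S) (keep : Sym2 A → Set ℝ → Bool) (h : Correct D S L) :
    Correct D (insert (Sum.inl p) S) (step D keep L (Sum.inl p)) :=
  (foldl_induction (P := GroundInv D S (insert (Sum.inl p) S))
    (fun _ _ _ h => h.visitGround hS hpS) ⟨h.progress, by simp⟩).progress.correct

/-! ### Intervals `I_{p,q}` -/

section Absorb

variable [Finite A] {r r' : A} {K L N : Entry A}

/-- Linking keeps the common vertices and only changes the root `r'` to `r`, which is how the edges
are rerouted. -/
theorem Link.absorbRight (h : Link K L) (hL : L.uf.WellFormed) (hr : L.uf.IsRoot r)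
    (hr' : L.uf.IsRoot r') (hne : r ≠ r') : Link (absorbRight r r' K) (absorb r r' L) := by
  intro x y
  simp only [ReebAlg.absorbRight, absorb, Forest.stored_link hr', h x]
  constructor
  · rintro ⟨hy, ⟨c, hc, hc', rfl, rfl⟩ | ⟨rfl, c, hc, hc', rfl, h⟩⟩
    · exact ⟨c, hc, hc', rfl, Forest.root_link_of_ne hL hr hr' hne hc' hy⟩
    · exact ⟨c, hc, hc', rfl, Forest.root_link_of_eq hL hr hr' hne hc' h⟩
  · rintro ⟨c, hc, hc', rfl, rfl⟩
    by_cases h : L.uf.root c = r'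
    · rw [Forest.root_link_of_eq hL hr hr' hne hc' h]
      exact ⟨hne, .inr ⟨rfl, c, hc, hc', rfl, h⟩⟩
    · rw [Forest.root_link_of_ne hL hr hr' hne hc' h]
      exact ⟨h, .inl ⟨c, hc, hc', rfl, rfl⟩⟩

theorem Link.absorb (h : Link L N) (hL : L.uf.WellFormed) (hr : L.uf.IsRoot r)
    (hr' : L.uf.IsRoot r') (hne : r ≠ r') : Link (absorb r r' L) N := by
  intro x y
  simp only [ReebAlg.absorb, Forest.stored_link hr', h _ y]
  constructor
  · rintro ⟨hy, ⟨c, hc, hc', rfl, rfl⟩ | ⟨rfl, c, hc, hc', h, rfl⟩⟩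
    · exact ⟨c, hc, hc', Forest.root_link_of_ne hL hr hr' hne hc hy, rfl⟩
    · exact ⟨c, hc, hc', Forest.root_link_of_eq hL hr hr' hne hc h, rfl⟩
  · rintro ⟨c, hc, hc', rfl, rfl⟩
    by_cases h : L.uf.root c = r'
    · rw [Forest.root_link_of_eq hL hr hr' hne hc h]
      exact ⟨hne, .inr ⟨rfl, c, hc, hc', h, rfl⟩⟩
    · rw [Forest.root_link_of_ne hL hr hr' hne hc h]
      exact ⟨h, .inl ⟨c, hc, hc', rfl, rfl⟩⟩

end Absorb

theorem IsPartialEquiv.unite_of_rel {R : A → A → Prop} (h : IsPartialEquiv R) {p q : A}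
    (hpq : R p q) : Unite R p q = R := by
  funext a b
  refine propext ⟨?_, .inl⟩
  rintro (h1 | ⟨h1, h2⟩ | ⟨h1, h2⟩)
  · exact h1
  · exact h.trans h1 (h.trans hpq h2)
  · exact h.trans h1 (h.trans (h.symm hpq) h2)

/-- The state of the inner loop for `I_{p,q}`; after the first union, `p` and `q` were in different
classes at a point of the interval to the left of all remaining entries. -/
structure GlueInv (D : Input A) (S S' : Set D.Item) (p q : A) (I : Set ℝ)
    (st : List (Entry A) × Bool) (rest : List (Entry A)) : Prop where
  progress : Progress D S S' st.1 rest
  -- A witness point is recorded instead of the whole predecessor cell: after a merge that cell need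
  -- not be constant for the old family, and `x` marks its united part.
  united : st.2 = false → ∃ x ∈ I, ¬ D.SimAt S x p q ∧ (∀ N ∈ rest, ∀ y ∈ N.cell, x < y) ∧
    ∀ N ∈ rest.head?, (N.cell ∩ I).Nonempty →
      ∀ K ∈ st.1.head?, x ∈ K.cell ∧ D.SimAt S x ≠ N.uf.Rel

theorem mergeWithPred_cases (L : Entry A) (X : List (Entry A)) :
    (mergeWithPred L X = L :: X ∧ ∀ K ∈ X.head?, K.uf.Rel ≠ L.uf.Rel) ∨
    ∃ K Y, X = K :: Y ∧ L.uf.Rel = K.uf.Rel ∧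
      mergeWithPred L X = ⟨K.cell ∪ L.cell, K.uf, Relation.Comp K.next L.next⟩ :: Y := by
  cases X with
  | nil => exact .inl ⟨rfl, by simp⟩
  | cons K Y =>
    by_cases h : L.uf.partition = K.uf.partition
    · refine .inr ⟨K, Y, rfl, Forest.partition_eq_iff.1 h, ?_⟩
      simp [mergeWithPred, h]
    · refine .inl ⟨by simp [mergeWithPred, h], ?_⟩
      rintro _ ⟨⟩
      exact fun he => h (Forest.partition_eq_iff.2 he.symm)

/-- The inner loop at an entry in which `p` and `q` are united. -/
theorem GlueInv.unite [Fintype A] {e : {e // e ∈ D.pairs}} {p q : A} {done rest : List (Entry A)}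
    {first : Bool} {J : Entry A} {r r' : A} (hS : D.Closed S) (he : ∀ p ∈ e.1, Sum.inl p ∈ S)
    (hpq : e.1 = s(p, q)) (hleft : ∀ i ∈ S, (D.interval i).fst ≤ (D.glue e).fst)
    (h : GlueInv D S (insert (Sum.inr e) S) p q (D.glue e : Set ℝ) (done, first) (J :: rest))
    (hJ : (J.cell ∩ (D.glue e : Set ℝ)).Nonempty) (hp : J.uf.Stored p) (hq : J.uf.Stored q)
    (hne : J.uf.root p ≠ J.uf.root q)
    (hr : (r = J.uf.root p ∧ r' = J.uf.root q) ∨ (r = J.uf.root q ∧ r' = J.uf.root p)) :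
    GlueInv D S (insert (Sum.inr e) S) p q (D.glue e : Set ℝ)
      ((split J (D.glue e)).2.2 ++
        (if first then mergeWithPred (absorb r r' (split J (D.glue e)).2.1)
            (((split J (D.glue e)).1 ++ done).modifyHead (absorbRight r r'))
          else absorb r r' (split J (D.glue e)).2.1 ::
            ((split J (D.glue e)).1 ++ done).modifyHead (absorbRight r r')), false) rest := by
  have hout : ∀ x ∉ (D.glue e : Set ℝ), D.SimAt (insert (Sum.inr e) S) x = D.SimAt S x :=
    fun x hx => Input.simAt_insert_inr_of_notMem hS he hx
  have hin : ∀ x ∈ D.glue e, D.SimAt (insert (Sum.inr e) S) x = Unite (D.SimAt S x) p q :=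
    fun x hx => Input.simAt_insert_inr_of_mem hS he hx hpq
  have hanti : ∀ x ∈ D.glue e, ∀ y, x < y → ∀ a b, D.SimAt S y a b → D.SimAt S x a b :=
    fun x hx y hxy a b => Input.simAt_anti hS hleft hx.1 hxy.le
  have hJr : ∀ x ∈ J.cell, J.uf.Rel = D.SimAt S x := h.progress.rest_rel J (by simp)
  have hJpq : ¬ J.uf.Rel p q := fun h => hne (Forest.rel_iff.1 h).2.2
  have : (D.glue e : Set ℝ).OrdConnected := by
    rw [NonemptyInterval.coe_def]; exact Set.ordConnected_Icc
  have hs := isSplit_split h.progress.wellFormed hJ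
  generalize (split J (D.glue e)).1 = lo at *
  generalize (split J (D.glue e)).2.1 = L at *
  generalize (split J (D.glue e)).2.2 = hi at *
  have hLs := hs.similar L (by simp)
  have hLp := (hLs.stored p).2 hp
  have hLq := (hLs.stored q).2 hq
  rw [← hLs.root, ← hLs.root] at hne hr
  have hrp := hLs.wellFormed.isRoot_root hLp
  have hrq := hLs.wellFormed.isRoot_root hLq
  obtain ⟨hrr, hrr', hrne, hlink⟩ : L.uf.IsRoot r ∧ L.uf.IsRoot r' ∧ r ≠ r' ∧
      (absorb r r' L).uf.Rel = Unite J.uf.Rel p q := by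
    rcases hr with ⟨rfl, rfl⟩ | ⟨rfl, rfl⟩
    · exact ⟨hrp, hrq, hne, by rw [absorb, hLs.wellFormed.rel_link hLp hLq hne, hLs.rel_eq]⟩
    · exact ⟨hrq, hrp, hne.symm, by
        rw [absorb, hLs.wellFormed.rel_link hLq hLp hne.symm, hLs.rel_eq, unite_comm]⟩
  have hLpq : (absorb r r' L).uf.Rel p q := by
    rw [hlink]
    exact .inr (.inl ⟨Forest.rel_self.2 hp, Forest.rel_self.2 hq⟩)
  have hLJ : ∀ x ∈ L.cell, x ∈ J.cell ∧ x ∈ D.glue e := fun x hx =>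
    (hs.cell_eq ▸ hx : x ∈ J.cell ∩ _)
  obtain ⟨x, hxJ, hxI⟩ := hJ
  have hxL : x ∈ L.cell := by rw [hs.cell_eq]; exact ⟨hxJ, hxI⟩
  have hlt : ∀ N ∈ rest, ∀ y ∈ N.cell, x < y := fun N hN y hy =>
    h.progress.below hN x hxJ y hy
  have hu := h.progress.split_update (f := absorbRight r r') (L' := absorb r r' L) hs hout
    (fun _ => rfl) (fun _ => rfl) rfl (hLs.wellFormed.link hrr hrr' hrne)
    (fun y hy => by rw [hlink, hin y (hLJ y hy).2, hJr y (hLJ y hy).1])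
    (fun he => hJpq (he ▸ hLpq))
    (fun K _ hKL => hKL.absorbRight hLs.wellFormed hrr hrr' hrne)
    (fun N _ hLN => hLN.absorb hLs.wellFormed hrr hrr' hrne) (fun _ N hN he => ?_)
  swap
  · have hN' := List.mem_of_mem_head? hN
    obtain ⟨y, hy⟩ := h.progress.subdivision.nonempty N (by simp [hN'])
    rw [he, h.progress.rest_rel N (by simp [hN']) y hy] at hLpq
    rw [hJr x hxJ] at hJpq
    exact hJpq (hanti x hxI y (hlt N hN' y hy) _ _ hLpq)
  have hunited : ∀ K X, x ∈ K.cell → ∃ x ∈ (D.glue e : Set ℝ), ¬ D.SimAt S x p q ∧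
      (∀ N ∈ rest, ∀ y ∈ N.cell, x < y) ∧
      ∀ N ∈ rest.head?, (N.cell ∩ (D.glue e : Set ℝ)).Nonempty →
        ∀ M ∈ (hi ++ K :: X).head?, x ∈ M.cell ∧ D.SimAt S x ≠ N.uf.Rel := by
    intro K X hxK
    refine ⟨x, hxI, hJr x hxJ ▸ hJpq, hlt, fun N hN hNI M hM => ⟨?_, ?_⟩⟩
    · rcases hs.hi_length with rfl | ⟨M, rfl⟩
      · obtain rfl : _ = M := by simpa using hM
        exact hxK
      -- If a right part remains, `J` reaches beyond the interval, so no later cell can meet it.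
      · obtain ⟨y, hyN, hyI⟩ := hNI
        obtain ⟨z, hz⟩ := hs.nonempty M (by simp)
        have h1 := h.progress.below (List.mem_of_mem_head? hN) z
          (hs.subset M (by simp) hz) y hyN
        exact absurd h1 (hs.hi_above M (by simp) y hyI z hz).not_gt
    · rw [← hJr x hxJ]
      exact h.progress.ne_head hN
  cases first with
  | true =>
    simp only [if_true]
    rcases mergeWithPred_cases (absorb r r' L) ((lo ++ done).modifyHead (absorbRight r r')) with
      ⟨hm, hne⟩ | ⟨K, Y, hX, hKL, hm⟩
    · rw [hm]
      refine ⟨hu.1 ?_, fun _ => hunited _ _ hxL⟩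
      rintro rfl K hK
      refine hne (absorbRight r r' K) ?_
      cases done with
      | nil => simp at hK
      | cons N done =>
        obtain rfl : N = K := by simpa using hK
        rfl
    · rw [hm]
      exact ⟨hu.2 K Y hX hKL, fun _ => hunited _ _ (.inr hxL)⟩
  | false =>
    simp only [Bool.false_eq_true, if_false]
    refine ⟨hu.1 ?_, fun _ => hunited _ _ hxL⟩
    intro _ K hK hKL
    obtain ⟨z, hzI, hz, hzlt, hz'⟩ := h.united rfl
    obtain ⟨hzK, hzJ⟩ := hz' J rfl ⟨x, hxJ, hxI⟩ K hK
    rw [h.progress.done_rel K (List.mem_of_mem_head? hK) z hzK, hin z hzI, hlink] at hKL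
    refine hzJ (Input.isPartialEquiv_simAt.unite_injective ?_ hz hKL)
    rw [hJr x hxJ]
    exact hanti z hzI x (hzlt J (by simp) x hxJ)

theorem GlueInv.visitGlue [Fintype A] {e : {e // e ∈ D.pairs}} {p q : A} {rest : List (Entry A)}
    {st : List (Entry A) × Bool} {J : Entry A} (hS : D.Closed S)
    (he : ∀ p ∈ e.1, Sum.inl p ∈ S) (hpq : e.1 = s(p, q))
    (hleft : ∀ i ∈ S, (D.interval i).fst ≤ (D.glue e).fst) (keep : Set ℝ → Bool)
    (h : GlueInv D S (insert (Sum.inr e) S) p q (D.glue e : Set ℝ) st (J :: rest)) :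
    GlueInv D S (insert (Sum.inr e) S) p q (D.glue e : Set ℝ)
      (visitGlue keep p q (D.glue e) st J) rest := by
  have hout : ∀ x ∉ (D.glue e : Set ℝ), D.SimAt (insert (Sum.inr e) S) x = D.SimAt S x :=
    fun x hx => Input.simAt_insert_inr_of_notMem hS he hx
  have hin : ∀ x ∈ D.glue e, D.SimAt (insert (Sum.inr e) S) x = Unite (D.SimAt S x) p q :=
    fun x hx => Input.simAt_insert_inr_of_mem hS he hx hpq
  by_cases hJ : (J.cell ∩ (D.glue e : Set ℝ)).Nonempty
  swap
  · rw [ReebAlg.visitGlue, if_neg hJ]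
    refine ⟨h.progress.skip fun x hx => hout x fun hxI => hJ ⟨x, hx, hxI⟩, fun hf => ?_⟩
    obtain ⟨z, hzI, hz, hzlt, -⟩ := h.united hf
    refine ⟨z, hzI, hz, fun N hN => hzlt N (by simp [hN]), ?_⟩
    rintro N hN ⟨y, hyN, hyI⟩
    obtain ⟨x, hx⟩ := h.progress.nonempty
    have hxy := h.progress.below (List.mem_of_mem_head? hN) x hx y hyN
    have hzx := hzlt J (by simp) x hx
    exact absurd ⟨x, hx, hzI.1.trans hzx.le, hxy.le.trans hyI.2⟩ hJ
  have hs : ((J.uf.compress p).compress q).Similar J.uf := by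
    have h1 := h.progress.wellFormed.compress_similar p
    exact (h1.wellFormed.compress_similar q).trans h1
  have h' : GlueInv D S (insert (Sum.inr e) S) p q (D.glue e : Set ℝ) (st.1, st.2)
      ({ J with uf := (J.uf.compress p).compress q } :: rest) := by
    refine ⟨h.progress.congr_uf hs, fun hf => ?_⟩
    have := h.united hf
    simpa [hs.rel_eq] using this
  rw [ReebAlg.visitGlue, if_pos hJ]
  have hJc : J.cell = ({ J with uf := (J.uf.compress p).compress q } : Entry A).cell := rfl
  rw [hJc] at hJ ⊢
  generalize ({ J with uf := (J.uf.compress p).compress q } : Entry A) = J' at *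
  obtain ⟨x, hxJ, hxI⟩ := id hJ
  have hJr := h'.progress.rest_rel J' (by simp)
  have hst : ∀ a ∈ e.1, J'.uf.Stored a := by
    intro a ha
    rw [← Forest.rel_self, hJr x hxJ, Input.simAt_self]
    exact ⟨he a ha, Input.mem_ground_of_mem_glue ha hxI⟩
  have hp := hst p (by simp [hpq])
  have hq := hst q (by simp [hpq])
  simp only [Forest.find, hp, hq, if_true]
  by_cases hne : J'.uf.root p ≠ J'.uf.root q
  · rw [if_pos hne]
    refine h'.unite hS he hpq hleft hJ hp hq hne ?_
    cases keep (J'.cell ∩ (D.glue e : Set ℝ)) <;> simp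
  · rw [if_neg hne]
    have hJpq : J'.uf.Rel p q := Forest.rel_iff.2 ⟨hp, hq, not_not.1 hne⟩
    refine ⟨h'.progress.skip fun y hy => ?_, fun hf => ?_⟩
    · by_cases hyI : y ∈ D.glue e
      · rw [hin y hyI]
        exact Input.isPartialEquiv_simAt.unite_of_rel (hJr y hy ▸ hJpq)
      · exact hout y hyI
    · obtain ⟨z, hzI, hz, hzlt, -⟩ := h'.united hf
      rw [hJr x hxJ] at hJpq
      exact absurd (Input.simAt_anti hS hleft hzI.1 (hzlt J' (by simp) x hxJ).le hJpq) hz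

theorem Correct.step_inr [Fintype A] {e : {e // e ∈ D.pairs}} {L : List (Entry A)}
    (hS : D.Closed S) (he : ∀ p ∈ e.1, Sum.inl p ∈ S)
    (hleft : ∀ i ∈ S, (D.interval i).fst ≤ (D.glue e).fst) (keep : Sym2 A → Set ℝ → Bool)
    (h : Correct D S L) : Correct D (insert (Sum.inr e) S) (step D keep L (Sum.inr e)) :=
  (foldl_induction
    (P := GlueInv D S (insert (Sum.inr e) S) (Quot.out e.1).1 (Quot.out e.1).2 (D.glue e : Set ℝ))
    (fun _ _ _ h => h.visitGlue hS he (Quot.out_eq e.1).symm hleft (keep e.1))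
    ⟨h.progress, by simp⟩).progress.correct

/-! ## The outer loop -/

theorem correct_nil : Correct D {i | i ∈ ([] : List D.Item)}
    [⟨Set.univ, Forest.empty, fun _ _ => False⟩] where
  subdivision := by
    refine ⟨by simp, by simp, by simp, ?_, by simp⟩
    simp [Forest.WellFormed, Forest.Stored, Forest.empty]
  rel_eq := by
    have h : ∀ x p q, ¬ D.SimAt {i | i ∈ ([] : List D.Item)} x p q := by
      intro x p q h
      have := (Input.simAt_self.1 (h.trans h.symm)).1
      simp at this
    simp only [List.mem_singleton, forall_eq]
    intro x _
    funext p q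
    rw [eq_iff_iff]
    exact iff_of_false (fun hpq => hpq.1 rfl) (h x p q)
  distinct := by simp

theorem Input.MayPrecede.fst_le {i j : D.Item} (h : D.MayPrecede i j) :
    (D.interval i).fst ≤ (D.interval j).fst := by
  rcases h with h | h
  · exact h.le
  · exact h.1.le

theorem Input.closed_of_isPrefix {order items : List D.Item} (horder : D.IsSortedList order)
    (hitems : items <+: order) : D.Closed {i | i ∈ items} := by
  intro e he p hp
  obtain ⟨t, rfl⟩ := hitems
  have hmem := horder.2.1 (Sum.inl p)
  rcases List.mem_append.1 hmem with h | h
  · exact h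
  · have h1 := (List.pairwise_append.1 horder.2.2).2.2 _ he _ h
    have h2 := (NonemptyInterval.le_def.1 (D.glue_le e p hp)).1
    rcases h1 with h1 | h1
    · exact absurd h1 (not_lt.2 h2)
    · simpa using h1.2

theorem correct_run [Fintype A] {order items : List D.Item} (horder : D.IsSortedList order)
    (keep : Sym2 A → Set ℝ → Bool) (hitems : items <+: order) :
    Correct D {i | i ∈ items} (run D keep items) := by
  induction items using List.reverseRecOn with
  | nil => exact correct_nil
  | append_singleton items i ih =>
    have hpre : items <+: order := (List.prefix_append _ _).trans hitems
    have hclosed := Input.closed_of_isPrefix horder hpre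
    have hclosed' := Input.closed_of_isPrefix horder hitems
    have hS : {j | j ∈ items ++ [i]} = insert i {j | j ∈ items} := by
      ext j
      simp [or_comm]
    have hnd : i ∉ items := by
      have := horder.1.sublist hitems.sublist
      rw [List.nodup_append] at this
      exact fun h => this.2.2 i h i (by simp) rfl
    have hleft : ∀ j ∈ {j | j ∈ items}, (D.interval j).fst ≤ (D.interval i).fst := by
      intro j hj
      have := horder.2.2.sublist hitems.sublist
      rw [List.pairwise_append] at this
      exact (this.2.2 j hj i (by simp)).fst_le
    have hrun : run D keep (items ++ [i]) = step D keep (run D keep items) i := by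
      simp [run]
    rw [hrun, hS]
    cases i with
    | inl p => exact (ih hpre).step_inl hclosed hnd keep
    | inr e =>
      refine (ih hpre).step_inr hclosed (fun p hp => ?_) hleft keep
      simpa using hclosed' e (by simp) p hp

section Correct

variable {L : List (Entry A)}

theorem Correct.partition_eq (h : Correct D S L) {J : Entry A} (hJ : J ∈ L) {x : ℝ}
    (hx : x ∈ J.cell) : J.uf.partition = D.fibrePartition S x := by
  rw [Forest.partition_eq_classes, Input.fibrePartition_eq_classes, h.rel_eq J hJ x hx]

theorem Subdivision.below_or_below (h : Subdivision L) {J J' : Entry A} (hJ : J ∈ L)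
    (hJ' : J' ∈ L) (hne : J ≠ J') : Below J.cell J'.cell ∨ Below J'.cell J.cell := by
  have : Std.Symm fun J J' : Entry A => Below J.cell J'.cell ∨ Below J'.cell J.cell :=
    ⟨fun _ _ => Or.symm⟩
  exact (h.below.imp (S := fun J J' => Below J.cell J'.cell ∨ Below J'.cell J.cell)
    Or.inl).forall hJ hJ' hne

theorem Subdivision.eq_of_mem (h : Subdivision L) {J J' : Entry A} (hJ : J ∈ L) (hJ' : J' ∈ L)
    {x : ℝ} (hx : x ∈ J.cell) (hx' : x ∈ J'.cell) : J = J' := by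
  by_contra hne
  rcases h.below_or_below hJ hJ' hne with h | h
  · exact lt_irrefl x (h x hx x hx')
  · exact lt_irrefl x (h x hx' x hx)

theorem Subdivision.ordConnected (h : Subdivision L) {J : Entry A} (hJ : J ∈ L) :
    J.cell.OrdConnected := by
  refine ⟨fun x hx y hy z hz => ?_⟩
  obtain ⟨M, hM, hzM⟩ := h.cover z
  by_cases hne : J = M
  · exact hne ▸ hzM
  · rcases h.below_or_below hJ hM hne with h | h
    · exact absurd (h y hy z hzM) hz.2.not_gt
    · exact absurd (h z hzM x hx) hz.1.not_gt

theorem Correct.isAdapted (h : Correct D S L) :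
    IsAdapted (D.fibrePartition S) {c | ∃ J ∈ L, J.cell = c} := by
  refine ⟨⟨?_, fun x => ?_⟩, ?_, ?_⟩
  · rintro ⟨J, hJ, he⟩
    exact (h.subdivision.nonempty J hJ).ne_empty he
  · obtain ⟨J, hJ, hx⟩ := h.subdivision.cover x
    refine ⟨J.cell, ⟨⟨J, hJ, rfl⟩, hx⟩, ?_⟩
    rintro _ ⟨⟨J', hJ', rfl⟩, hx'⟩
    rw [h.subdivision.eq_of_mem hJ hJ' hx hx']
  · rintro _ ⟨J, hJ, rfl⟩
    exact h.subdivision.ordConnected hJ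
  · rintro _ ⟨J, hJ, rfl⟩ x hx y hy
    rw [← h.partition_eq hJ hx, ← h.partition_eq hJ hy]

/-- A cell to the left of another one is followed by an adjacent cell with a different
partition. -/
theorem Correct.exists_between (h : Correct D S L) {J J' : Entry A} (hJ : J ∈ L) (hJ' : J' ∈ L)
    (hlt : Below J.cell J'.cell) {x y : ℝ} (hx : x ∈ J.cell) (hy : y ∈ J'.cell) :
    ∃ z, x ≤ z ∧ z ≤ y ∧ D.fibrePartition S x ≠ D.fibrePartition S z := by
  obtain ⟨X, Y, rfl⟩ := List.append_of_mem hJ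
  have hb := h.subdivision.below
  rw [List.pairwise_append, List.pairwise_cons] at hb
  have hJY : J' ∈ Y := by
    rcases List.mem_append.1 hJ' with hm | hm
    · exact absurd (hb.2.2 J' hm J (by simp) y hy x hx) (hlt x hx y hy).not_gt
    · rcases List.mem_cons.1 hm with rfl | hm
      · exact absurd (hlt x hx x hx) (lt_irrefl x)
      · exact hm
  cases Y with
  | nil => simp at hJY
  | cons N Y =>
    have hd := h.distinct
    rw [List.map_append, List.map_cons, List.map_cons, List.isChain_append, List.isChain_cons]
      at hd
    have hJN := hd.2.1.1 _ rfl
    have hN : N ∈ X ++ J :: N :: Y := by simp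
    have key : ∀ z ∈ N.cell, D.fibrePartition S x ≠ D.fibrePartition S z := by
      intro z hz he
      rw [Input.fibrePartition_eq_iff, ← h.rel_eq J hJ x hx, ← h.rel_eq N hN z hz] at he
      exact hJN he
    rcases List.mem_cons.1 hJY with rfl | hm
    · exact ⟨y, (hlt x hx y hy).le, le_rfl, key y hy⟩
    · obtain ⟨z, hz⟩ := h.subdivision.nonempty N hN
      exact ⟨z, (hb.2.1.1 N (by simp) x hx z hz).le,
        ((List.pairwise_cons.1 hb.2.1.2).1 J' hm z hz y hy).le, key z hz⟩

theorem Correct.isCoarsestAdapted (h : Correct D S L) :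
    IsCoarsestAdapted (D.fibrePartition S) {c | ∃ J ∈ L, J.cell = c} := by
  refine ⟨h.isAdapted, fun Q hQ K hK => ?_⟩
  obtain ⟨x, hx⟩ : K.Nonempty := Set.nonempty_iff_ne_empty.2 fun he => hQ.1.1 (he ▸ hK)
  obtain ⟨J, hJ, hxJ⟩ := h.subdivision.cover x
  refine ⟨J.cell, ⟨J, hJ, rfl⟩, fun y hy => ?_⟩
  obtain ⟨J', hJ', hyJ'⟩ := h.subdivision.cover y
  by_cases hne : J = J'
  · exact hne ▸ hyJ'
  · have := hQ.2.1 K hK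
    rcases h.subdivision.below_or_below hJ hJ' hne with hlt | hlt
    · obtain ⟨z, hxz, hzy, hz⟩ := h.exists_between hJ hJ' hlt hxJ hyJ'
      exact absurd (hQ.2.2 K hK x hx z (this.out hx hy ⟨hxz, hzy⟩)) hz
    · obtain ⟨z, hyz, hzx, hz⟩ := h.exists_between hJ' hJ hlt hyJ' hxJ
      exact absurd (hQ.2.2 K hK y hy z (this.out hy hx ⟨hyz, hzx⟩)) hz

theorem Correct.next_iff [Finite A] (h : Correct D S L) {J J' : Entry A} (hJJ' : [J, J'] <:+: L)
    (x y : A) :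
    J.next x y ↔ J.uf.IsRoot x ∧ J'.uf.IsRoot y ∧ (J.uf.cls x ∩ J'.uf.cls y).Nonempty := by
  have hl := List.isChain_pair.1 (h.subdivision.link.infix hJJ')
  have hJ := h.subdivision.wellFormed J (hJJ'.subset (by simp))
  have hJ' := h.subdivision.wellFormed J' (hJJ'.subset (by simp))
  rw [hl x y]
  constructor
  · rintro ⟨c, hc, hc', rfl, rfl⟩
    have hr := hJ.isRoot_root hc
    have hr' := hJ'.isRoot_root hc'
    exact ⟨hr, hr', c, ⟨hr.stored, hc, hr.root_eq.symm⟩, hr'.stored, hc', hr'.root_eq.symm⟩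
  · rintro ⟨hx, hy, c, hc, hc'⟩
    exact ⟨c, hc.2.1, hc'.2.1, hc.2.2.trans hx.root_eq, hc'.2.2.trans hy.root_eq⟩

theorem Correct.stored_and_cls_subset (h : Correct D S L) (hS : D.Closed S) {I : Set ℝ} {a : ℝ}
    (hleft : ∀ i ∈ S, (D.interval i).fst ≤ a) (hI : ∀ x ∈ I, a ≤ x) {J J' : Entry A}
    (hJ : J ∈ L) (hJ' : J' ∈ L) (hlt : Below J.cell J'.cell) (hJI : ¬ Below J.cell I) {r : A}
    (hr : J'.uf.Stored r) : J.uf.Stored r ∧ J'.uf.cls r ⊆ J.uf.cls r := by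
  simp only [Below, not_forall, not_lt] at hJI
  obtain ⟨x, hx, z, hz, hzx⟩ := hJI
  obtain ⟨y, hy⟩ := h.subdivision.nonempty J' hJ'
  have key : ∀ p q, J'.uf.Rel p q → J.uf.Rel p q := by
    intro p q hpq
    rw [h.rel_eq J' hJ' y hy] at hpq
    rw [h.rel_eq J hJ x hx]
    exact Input.simAt_anti hS hleft ((hI z hz).trans hzx) (hlt x hx y hy).le hpq
  exact ⟨Forest.rel_self.1 (key r r (Forest.rel_self.2 hr)), fun q hq => key r q hq⟩

end Correct

end ReebAlg

theorem mainTheorem10 {A : Type*} [Fintype A] (D : ReebAlg.Input A)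
    (order : List D.Item) (horder : D.IsSortedList order)
    (keep : Sym2 A → Set ℝ → Bool)
    (items : List D.Item) (hitems : items <+: order) :
    let S : Set D.Item := {i | i ∈ items}
    let L : List (ReebAlg.Entry A) := ReebAlg.run D keep items
    -- the cells are listed from left to right
    L.Pairwise (fun J J' => ReebAlg.Below J.cell J'.cell) ∧
    -- (i)
    (∀ J ∈ L, ∀ x ∈ J.cell, J.uf.partition = D.fibrePartition S x) ∧
    -- (ii)
    ReebAlg.IsCoarsestAdapted (D.fibrePartition S) {c | ∃ J ∈ L, J.cell = c} ∧
    -- (iii)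
    (∀ J J' : ReebAlg.Entry A, [J, J'] <:+: L → ∀ x y : A,
      J.next x y ↔ J.uf.IsRoot x ∧ J'.uf.IsRoot y ∧ (J.uf.cls x ∩ J'.uf.cls y).Nonempty) ∧
    -- (iv)
    (∀ i : D.Item, items.getLast? = some i → ∀ J ∈ L, ∀ J' ∈ L,
      ReebAlg.Below J.cell J'.cell → ¬ ReebAlg.Below J.cell (D.interval i : Set ℝ) →
        ∀ r : A, J'.uf.Stored r → J.uf.Stored r ∧ J'.uf.cls r ⊆ J.uf.cls r) := by
  have h := ReebAlg.correct_run horder keep hitems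
  refine ⟨h.subdivision.below, fun J hJ x hx => h.partition_eq hJ hx, h.isCoarsestAdapted,
    fun J J' hJJ' => h.next_iff hJJ', fun i hi J hJ J' hJ' hlt hJI r hr => ?_⟩
  refine h.stored_and_cls_subset (ReebAlg.Input.closed_of_isPrefix horder hitems)
    (a := (D.interval i).fst) (fun j hj => ?_) (fun x hx => hx.1) hJ hJ' hlt hJI hr
  obtain ⟨l, rfl⟩ := List.getLast?_eq_some_iff.1 hi
  rcases List.mem_append.1 hj with hj | hj
  · have := horder.2.2.sublist hitems.sublist
    rw [List.pairwise_append] at this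
    exact (this.2.2 j hj i (by simp)).fst_le
  · rw [List.mem_singleton.1 hj]
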